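/- \textbf{Setting.} Let $E$ be a measurable space, $\Pi$ a Markov kernel on $E$, and $0<\alpha<1$. Let $X=(X_n)_{n\ge 0}$ be a homogeneous Markov process with kernel $\Pi$ on a measurable space $\Omega$ with probability measures $(\mathbb P_x)_{x\in E}$, $X_0\sim\delta_x$ under $\mathbb P_x$. Let $\xi^{(i)}_n$ ($i=1,2$, $n\ge0$) be random variables on $\Omega$ that, under every $\mathbb P_x$, are mutually independent, uniformly distributed on $(0,1)$, and independent of $X$. Let $\tilde X$ be $X$ killed at each date $n\ge 1$ with probability $1-\alpha$, independently of $X$: $\tilde X_n=X_n$ for $n<\zeta$ and $\tilde X_n=K$ (a cemetery, where all functions are $0$) for $n\ge\zeta$, where $\zeta$ is independent of $X$ and $\mathbb P_x(\zeta>n)=\alpha^n$. Let $f,g,h:E\to\mathbb R$ be measurable with $\sup_n|f(\tilde X_n)|,\ \sup_n|g(\tilde X_n)|,\ \sup_n|h(\tilde X_n)|\in L^1(\mathbb P_x)$ for every $x\in E$. An admissible stopping time of player $i$ is a stopping time $\tau_i$, with values in $\mathbb N_0\cup\{\infty\}$, of the filtration $\sigma(X_0,\dots,X_n,\xi^{(i)}_0,\dots,\xi^{(i)}_n)$,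 $n\ge0$. Consider the zero-sum game in which player 1 maximizes and player 2 minimizes $$J(x;\tau_1,\tau_2)=\mathbb E_x\big[\alpha^{\tau_1}f(X_{\tau_1})1_{\{\tau_1<\tau_2\}}+\alpha^{\tau_2}g(X_{\tau_2})1_{\{\tau_2<\tau_1\}}+\alpha^{\tau_1}h(X_{\tau_1})1_{\{\tau_1=\tau_2<\infty\}}\big]$$ over admissible stopping times. A Markovian strategy of player $i$ is a measurable function $p^{(i)}:E\to[0,1]$, identified with the stopping time $\tau^{p^{(i)}}=\inf\{n:p^{(i)}(X_n)\ge\xi^{(i)}_n\}$; it is pure if $p^{(i)}(x)\in\{0,1\}$ for all $x$. A pair $(p^{(1)},p^{(2)})$ is a global Markovian equilibrium with value $V$ if, for every $x\in E$, $\tau^{p^{(1)}}$ attains $\sup_{\tau_1}J(x;\tau_1,\tau^{p^{(2)}})$, $\tau^{p^{(2)}}$ attains $\inf_{\tau_2}J(x;\tau^{p^{(1)}},\tau_2)$, and $V(x)=J(x;\tau^{p^{(1)}},\tau^{p^{(2)}})$. Write $\Pi V(x)=\int V(y)\,\Pi(x,dy)$ and $\operatorname{med}(a,b,c)$ for the middle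 value of $a,b,c$. \textbf{Theorem.} Suppose $h(x)=\operatorname{med}(f(x),h(x),g(x))$ for all $x\in E$. (A) There is a measurable $V:E\to\mathbb R$, $\Pi(x,\cdot)$-integrable for every $x$, with $$V(x)=\begin{cases}\operatorname{med}(f(x),\alpha\Pi V(x),g(x)) & \text{if } f(x)<g(x),\\ h(x) & \text{if } f(x)\ge g(x),\end{cases}\qquad x\in E.\tag{1}$$ Indeed, put $V^0=f\wedge h$ and let $V^{n+1}(x)$ be the right-hand side of (1) with $V$ replaced by $V^n$. Then the functions $V^n$ are measurable and $\Pi(x,\cdot)$-integrable for every $x$, the sequence $(V^n)_n$ is pointwise non-decreasing, and it converges pointwise to such a solution $V$. (B) Let $V:E\to\mathbb R$ be any measurable solution of (1), and let $p^{(1)},p^{(2)}:E\to[0,1]$ be any measurable functions such that for all $x\in E$ (with all functions evaluated at $x$; a value that is not specified is arbitrary in $[0,1]$): (i) $f>g\Rightarrow p^{(1)}=p^{(2)}=1$; (ii) $f=g,\ \alpha\Pi V<V\Rightarrow p^{(1)}=1$; (iii) $f=g,\ \alpha\Pi V=V\Rightarrow p^{(1)}=p^{(2)}$; (iv) $f=g,\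 \alpha\Pi V>V\Rightarrow p^{(2)}=1$; (v) $f<g,\ g<\alpha\Pi V\Rightarrow p^{(1)}=0,\ p^{(2)}=1$; (vi) $f<g,\ g=\alpha\Pi V\Rightarrow p^{(1)}=0$; (vii) $f<g,\ f<\alpha\Pi V<g\Rightarrow p^{(1)}=p^{(2)}=0$; (viii) $f<g,\ f=\alpha\Pi V\Rightarrow p^{(2)}=0$; (ix) $f<g,\ \alpha\Pi V<f\Rightarrow p^{(1)}=1,\ p^{(2)}=0$. Then $(p^{(1)},p^{(2)})$ is a global Markovian equilibrium with value $V$. Moreover, for every measurable solution $V$ of (1) there are pure $p^{(1)},p^{(2)}$ satisfying (i)--(ix), which therefore form a pure global Markovian equilibrium with value $V$. -/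

import Mathlib

open MeasureTheory ProbabilityTheory Filter Topology

noncomputable section

namespace MarkovDynkin

/-- The middle value among three real numbers. -/
def med (a b c : ℝ) : ℝ := min (max a b) (min (max a c) (max b c))

/-- The probabilistic setting of a Markovian Dynkin game with transition kernel `Q` and discount
factor `α`, on a measurable space `Ω` with a family of probability measures `P x`.
The players are numbered `0` (first player) and `1` (second player). -/
structure Setting {E : Type*} [MeasurableSpace E] (Ω : Type*) [MeasurableSpace Ω]
    (Q : Kernel E E) (α : ℝ) where
  /-- the law started from `x` -/
  P : E → Measure Ω
  /-- the state process -/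
  X : ℕ → Ω → E
  /-- the randomization devices of the two players -/
  ξ : Fin 2 → ℕ → Ω → ℝ
  /-- the time at which the killed process is sent to the cemetery -/
  ζ : Ω → ℕ
  isProbabilityMeasure : ∀ x, IsProbabilityMeasure (P x)
  measurable_X : ∀ n, Measurable (X n)
  measurable_ξ : ∀ i n, Measurable (ξ i n)
  measurable_ζ : Measurable ζ
  /-- `X` starts from `x` under `P x`. -/
  initial : ∀ x, (P x).map (X 0) = Measure.dirac x
  /-- `X` is a homogeneous Markov process with kernel `Q`. -/
  markov : ∀ x n, ∀ B : Set E, MeasurableSet B →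
    (P x)[(X (n + 1) ⁻¹' B).indicator (fun _ => (1 : ℝ)) |
        ⨆ k ≤ n, MeasurableSpace.comap (X k) inferInstance]
      =ᵐ[P x] fun ω => (Q (X n ω)).real B
  /-- Each device is uniformly distributed on `(0, 1)`. -/
  uniform_ξ : ∀ x i n, pdf.IsUniform (ξ i n) (Set.Ioo 0 1) (P x)
  /-- All the devices, of both players and at all dates, are mutually independent. -/
  indep_ξ : ∀ x, iIndepFun (fun q : Fin 2 × ℕ => ξ q.1 q.2) (P x)
  /-- The devices are independent of the state process. -/
  indep_X_ξ : ∀ x, IndepFun (fun ω n => X n ω) (fun ω (q : Fin 2 × ℕ) => ξ q.1 q.2 ω) (P x)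
  /-- Killing occurs at each date `n ≥ 1` with probability `1 - α`. -/
  survival : ∀ x n, P x {ω | n < ζ ω} = ENNReal.ofReal (α ^ n)
  /-- Killing is independent of the state process. -/
  indep_X_ζ : ∀ x, IndepFun (fun ω n => X n ω) ζ (P x)

/-- The payoff functions of the two players: `f i` when player `i` stops first, `g i` when the
other player stops first, and `h i` when both stop simultaneously. -/
structure Payoffs (E : Type*) where
  f : Fin 2 → E → ℝ
  g : Fin 2 → E → ℝ
  h : Fin 2 → E → ℝ

/-- The zero-sum game: `f₁ = f`, `g₁ = g`, `h₁ = h`, `f₂ = -g`, `g₂ = -f`, `h₂ = -h`. -/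
def Payoffs.zeroSum {E : Type*} (f g h : E → ℝ) : Payoffs E where
  f := ![f, -g]
  g := ![g, -f]
  h := ![h, -h]

/-- A Markovian (randomized) stopping strategy: a measurable function `E → [0, 1]`. -/
def IsStrategy {E : Type*} [MeasurableSpace E] (p : E → ℝ) : Prop :=
  Measurable p ∧ ∀ x, p x ∈ Set.Icc (0 : ℝ) 1

/-- A pure strategy only takes the values `0` and `1`. -/
def IsPure {E : Type*} (p : E → ℝ) : Prop := ∀ x, p x = 0 ∨ p x = 1

namespace Setting

variable {E Ω : Type*} [MeasurableSpace E] [mΩ : MeasurableSpace Ω] {Q : Kernel E E} {α : ℝ}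

/-- The process killed at time `ζ`; `none` is the cemetery state. -/
def killed (S : Setting Ω Q α) (n : ℕ) (ω : Ω) : Option E :=
  if n < S.ζ ω then some (S.X n ω) else none

/-- `sup_n |u(X̃_n)|` is integrable under each `P x`, where `u` vanishes at the cemetery. -/
def SupIntegrable (S : Setting Ω Q α) (u : E → ℝ) : Prop :=
  ∀ x, ∫⁻ ω, ⨆ n, ‖(S.killed n ω).elim 0 u‖ₑ ∂(S.P x) < ⊤

/-- The standing integrability assumption of the game. -/
def IntegrablePayoffs (S : Setting Ω Q α) (G : Payoffs E) : Prop :=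
  ∀ i, S.SupIntegrable (G.f i) ∧ S.SupIntegrable (G.g i) ∧ S.SupIntegrable (G.h i)

/-- The information of player `i`: `σ(X_0, …, X_n, ξ^i_0, …, ξ^i_n)`. -/
def info (S : Setting Ω Q α) (i : Fin 2) : Filtration ℕ mΩ where
  seq n := ⨆ k ≤ n, (MeasurableSpace.comap (S.X k) inferInstance ⊔
    MeasurableSpace.comap (S.ξ i k) inferInstance)
  mono' _ _ hmn := biSup_mono fun _ hk => hk.trans hmn
  le' _ := iSup₂_le fun k _ => sup_le (S.measurable_X k).comap_le (S.measurable_ξ i k).comap_le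

/-- The admissible stopping times of player `i`, with values in `ℕ ∪ {∞}`. -/
def Admissible (S : Setting Ω Q α) (i : Fin 2) : Set (Ω → WithTop ℕ) :=
  {τ | IsStoppingTime (S.info i) τ}

/-- The Markovian randomized stopping time `inf {n | p(X_n) ≥ ξ^i_n}` of player `i`, which is
`∞` when the set is empty. -/
def markovTime (S : Setting Ω Q α) (i : Fin 2) (p : E → ℝ) (ω : Ω) : WithTop ℕ :=
  open scoped Classical in
  if ∃ n : ℕ, p (S.X n ω) ≥ S.ξ i n ω
  then ((sInf {n : ℕ | p (S.X n ω) ≥ S.ξ i n ω} : ℕ) : WithTop ℕ) else ⊤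

/-- The discounted reward of a player who uses `τ` against `σ`: `α^τ f(X_τ)` on `{τ < σ}`,
`α^σ g(X_σ)` on `{σ < τ}`, `α^τ h(X_τ)` on `{τ = σ < ∞}`, and zero on `{τ = σ = ∞}`. -/
def reward (S : Setting Ω Q α) (f g h : E → ℝ) (τ σ : Ω → WithTop ℕ) (ω : Ω) : ℝ :=
  if τ ω < σ ω then α ^ (τ ω).untopD 0 * f (S.X ((τ ω).untopD 0) ω)
  else if σ ω < τ ω then α ^ (σ ω).untopD 0 * g (S.X ((σ ω).untopD 0) ω)
  else if τ ω < ⊤ then α ^ (τ ω).untopD 0 * h (S.X ((τ ω).untopD 0) ω)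
  else 0

/-- Expected reward of the first player when the stopping times `τ₁`, `τ₂` are used. -/
def J₁ (S : Setting Ω Q α) (G : Payoffs E) (x : E) (τ₁ τ₂ : Ω → WithTop ℕ) : ℝ :=
  ∫ ω, S.reward (G.f 0) (G.g 0) (G.h 0) τ₁ τ₂ ω ∂(S.P x)

/-- Expected reward of the second player when the stopping times `τ₁`, `τ₂` are used. -/
def J₂ (S : Setting Ω Q α) (G : Payoffs E) (x : E) (τ₁ τ₂ : Ω → WithTop ℕ) : ℝ :=
  ∫ ω, S.reward (G.f 1) (G.g 1) (G.h 1) τ₂ τ₁ ω ∂(S.P x)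

/-- Nash equilibrium for the initial state `x`: both stopping times are admissible and each
expected reward equals the supremum over the admissible stopping times of that player. -/
def IsNash (S : Setting Ω Q α) (G : Payoffs E) (x : E) (τ₁ τ₂ : Ω → WithTop ℕ) : Prop :=
  τ₁ ∈ S.Admissible 0 ∧ τ₂ ∈ S.Admissible 1 ∧
  IsLUB ((fun τ => S.J₁ G x τ τ₂) '' S.Admissible 0) (S.J₁ G x τ₁ τ₂) ∧
  IsLUB ((fun τ => S.J₂ G x τ₁ τ) '' S.Admissible 1) (S.J₂ G x τ₁ τ₂)

/-- Global Markovian (randomized) equilibrium: a Nash equilibrium for every initial state. -/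
def IsGlobalEquilibrium (S : Setting Ω Q α) (G : Payoffs E) (p₁ p₂ : E → ℝ) : Prop :=
  IsStrategy p₁ ∧ IsStrategy p₂ ∧
  ∀ x, S.IsNash G x (S.markovTime 0 p₁) (S.markovTime 1 p₂)

/-- `V` is the value (for the first player) of the pair `(p₁, p₂)`. -/
def HasValue (S : Setting Ω Q α) (G : Payoffs E) (p₁ p₂ V : E → ℝ) : Prop :=
  ∀ x, V x = S.J₁ G x (S.markovTime 0 p₁) (S.markovTime 1 p₂)

end Setting

/-- The discounted one-step expectation `α Π V (x)`. -/
def contVal {E : Type*} [MeasurableSpace E] (Q : Kernel E E) (α : ℝ) (V : E → ℝ) (x : E) : ℝ :=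
  α * ∫ y, V y ∂(Q x)

/-- The operator sending `V` to `med(f, αΠV, g)` on `{f < g}` and to `h` on `{f ≥ g}`. -/
def step {E : Type*} [MeasurableSpace E] (Q : Kernel E E) (α : ℝ) (f g h V : E → ℝ) (x : E) : ℝ :=
  if f x < g x then med (f x) (contVal Q α V x) (g x) else h x

/-- The iteration `V^0 = f ∧ h`, `V^{n+1} = step V^n`. -/
def iter {E : Type*} [MeasurableSpace E] (Q : Kernel E E) (α : ℝ) (f g h : E → ℝ) :
    ℕ → E → ℝ
  | 0 => fun x => min (f x) (h x)
  | n + 1 => step Q α f g h (iter Q α f g h n)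

/-- The nine-case rule that selects the strategies `p₁`, `p₂` from `V`; where a case leaves a
strategy unconstrained, it may take any value in `[0, 1]`. -/
structure NineCaseRule {E : Type*} [MeasurableSpace E] (Q : Kernel E E) (α : ℝ)
    (f g V p₁ p₂ : E → ℝ) : Prop where
  i : ∀ x, g x < f x → p₁ x = 1 ∧ p₂ x = 1
  ii : ∀ x, f x = g x → contVal Q α V x < V x → p₁ x = 1
  iii : ∀ x, f x = g x → contVal Q α V x = V x → p₁ x = p₂ x
  iv : ∀ x, f x = g x → V x < contVal Q α V x → p₂ x = 1
  v : ∀ x, f x < g x → g x < contVal Q α V x → p₁ x = 0 ∧ p₂ x = 1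
  vi : ∀ x, f x < g x → g x = contVal Q α V x → p₁ x = 0
  vii : ∀ x, f x < g x → f x < contVal Q α V x → contVal Q α V x < g x → p₁ x = 0 ∧ p₂ x = 0
  viii : ∀ x, f x < g x → f x = contVal Q α V x → p₂ x = 0
  ix : ∀ x, f x < g x → contVal Q α V x < f x → p₁ x = 1 ∧ p₂ x = 0

end MarkovDynkin

end

noncomputable section

namespace MarkovDynkin

/-! Part (B) is a verification argument. Fix a Markovian strategy `p` of one player such that `V`
dominates both `p h + (1 - p) f` (the opponent stops now) and `p g + (1 - p) αΠV` (the opponent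
waits). Whatever admissible time the opponent uses, the payoff collected before date `n`, plus `α^n
V(X_n)` on the event that nobody has stopped yet, has non-increasing mean. This mean starts at `V x`
and tends to the expected reward, which is therefore at most `V x` (`integral_reward_le`).

The one-step inequality (`setIntegral_payoff_le`) rests on two facts. The device `ξ^j_n` is uniform
and independent of all that the opponent knows, so the event of stopping can be replaced by the
weight `p(X_n)` (`setIntegral_device_le`); and the Markov property survives when all devices are
added to the past (`setIntegral_X_succ`). Domination and the vanishing of the remainder come from
killing: given the path, `α^n |u(X_n)|` is the mean over `ζ` of `|u|` along the killed process.

The nine cases yield the two inequalities for `p₂`, and the reversed ones for `p₁`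
(`NineCaseRule.upper`, `NineCaseRule.lower`). Passing to `(-g, -f, -h, -V)` reduces the second
player to the first, and the two bounds squeeze the reward of the pair at `V`.

Part (A) is monotone iteration: `f ∧ h` is a subsolution, `step` is monotone, and all iterates are
bounded by the integrable function `|f| + |g| + |h|`, so dominated convergence turns the limit into
a fixed point (`exists_fixedPoint`). -/

lemma isPiSystem_inter_measurableSet {Ω : Type*} (m₁ m₂ : MeasurableSpace Ω) :
    IsPiSystem {s : Set Ω | ∃ a b, MeasurableSet[m₁] a ∧ MeasurableSet[m₂] b ∧ s = a ∩ b} := by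
  rintro _ ⟨a, b, ha, hb, rfl⟩ _ ⟨a', b', ha', hb', rfl⟩ _
  exact ⟨a ∩ a', b ∩ b', ha.inter ha', hb.inter hb', Set.inter_inter_inter_comm _ _ _ _⟩

lemma sup_eq_generateFrom_inter {Ω : Type*} (m₁ m₂ : MeasurableSpace Ω) :
    m₁ ⊔ m₂ = MeasurableSpace.generateFrom
      {s : Set Ω | ∃ a b, MeasurableSet[m₁] a ∧ MeasurableSet[m₂] b ∧ s = a ∩ b} := by
  refine le_antisymm (sup_le ?_ ?_) (MeasurableSpace.generateFrom_le ?_)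
  · exact fun s hs => MeasurableSpace.measurableSet_generateFrom
      ⟨s, Set.univ, hs, MeasurableSet.univ, by simp⟩
  · exact fun s hs => MeasurableSpace.measurableSet_generateFrom
      ⟨Set.univ, s, MeasurableSet.univ, hs, by simp⟩
  · rintro _ ⟨a, b, ha, hb, rfl⟩
    exact MeasurableSet.inter (le_sup_left (a := m₁) (b := m₂) a ha)
      (le_sup_right (a := m₁) (b := m₂) b hb)

/-! ### The Markov property in the presence of the devices -/

namespace Setting

variable {E Ω : Type*} [MeasurableSpace E] [mΩ : MeasurableSpace Ω] {Q : Kernel E E} {α : ℝ}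

/-- The information carried by `X_0, …, X_n`. -/
@[reducible]
def past (S : Setting Ω Q α) (n : ℕ) : MeasurableSpace Ω :=
  ⨆ k ≤ n, MeasurableSpace.comap (S.X k) inferInstance

/-- The information carried by all the randomization devices. -/
@[reducible]
def devices (S : Setting Ω Q α) : MeasurableSpace Ω :=
  MeasurableSpace.comap (fun ω (q : Fin 2 × ℕ) => S.ξ q.1 q.2 ω) inferInstance

/-- The state process together with all devices but `ξ^j_n`. -/
def others (S : Setting Ω Q α) (j : Fin 2) (n : ℕ) (ω : Ω) :
    (ℕ → E) × ({q : Fin 2 × ℕ // q ≠ (j, n)} → ℝ) :=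
  (fun k => S.X k ω, fun q => S.ξ q.1.1 q.1.2 ω)

lemma past_le (S : Setting Ω Q α) (n : ℕ) : S.past n ≤ mΩ :=
  iSup₂_le fun k _ => (S.measurable_X k).comap_le

lemma measurable_paths (S : Setting Ω Q α) : Measurable fun ω n => S.X n ω :=
  measurable_pi_lambda _ S.measurable_X

lemma measurable_allDevices (S : Setting Ω Q α) :
    Measurable fun ω (q : Fin 2 × ℕ) => S.ξ q.1 q.2 ω :=
  measurable_pi_lambda _ fun q => S.measurable_ξ q.1 q.2

lemma devices_le (S : Setting Ω Q α) : S.devices ≤ mΩ := S.measurable_allDevices.comap_le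

lemma measurable_others (S : Setting Ω Q α) (j : Fin 2) (n : ℕ) : Measurable (S.others j n) :=
  S.measurable_paths.prodMk (measurable_pi_lambda _ fun q => S.measurable_ξ q.1.1 q.1.2)

lemma measurable_X_past (S : Setting Ω Q α) {k n : ℕ} (h : k ≤ n) : Measurable[S.past n] (S.X k) :=
  Measurable.mono (comap_measurable _) (le_iSup₂ (f := fun k (_ : k ≤ n) =>
    MeasurableSpace.comap (S.X k) inferInstance) k h) le_rfl

lemma past_le_comap_paths (S : Setting Ω Q α) (n : ℕ) :
    S.past n ≤ MeasurableSpace.comap (fun ω k => S.X k ω) inferInstance :=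
  iSup₂_le fun k _ => Measurable.comap_le
    ((measurable_pi_apply k).comp (comap_measurable fun ω k => S.X k ω))

lemma measure_past_inter [IsMarkovKernel Q] (S : Setting Ω Q α) (x : E) (n : ℕ) {D : Set Ω}
    (hD : MeasurableSet[S.past n] D) {B : Set E} (hB : MeasurableSet B) :
    S.P x (D ∩ S.X (n + 1) ⁻¹' B) = ∫⁻ ω in D, Q (S.X n ω) B ∂S.P x := by
  have := S.isProbabilityMeasure x
  have hD' := S.past_le n D hD
  have hXB := S.measurable_X (n + 1) hB
  have h1 := setIntegral_condExp (μ := S.P x) (S.past_le n)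
    ((integrable_const (1 : ℝ)).indicator hXB) hD
  have h2 : ∫ ω in D, (Q (S.X n ω)).real B ∂S.P x
      = ∫ ω in D, (S.X (n + 1) ⁻¹' B).indicator (fun _ => (1 : ℝ)) ω ∂S.P x := by
    rw [← h1]
    exact setIntegral_congr_ae hD' ((S.markov x n B hB).mono fun ω h _ => h.symm)
  rw [setIntegral_indicator hXB] at h2
  have hm : Measurable fun ω => Q (S.X n ω) B := (Q.measurable_coe hB).comp (S.measurable_X n)
  simp only [Measure.real] at h2
  rw [integral_toReal hm.aemeasurable (by simp)] at h2
  simp only [integral_const, smul_eq_mul, mul_one, Measure.real, Measure.restrict_apply_univ] at h2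
  refine ((ENNReal.toReal_eq_toReal_iff' ?_ (by simp)).1 h2).symm
  refine ((lintegral_mono (g := fun _ => 1) fun ω => prob_le_one).trans_lt ?_).ne
  simp

/-- The Markov property with respect to the past of `X` and all the devices. -/
lemma measure_inter_eq_lintegral [IsMarkovKernel Q] (S : Setting Ω Q α) (x : E) (n : ℕ) {D : Set Ω}
    (hD : MeasurableSet[S.past n ⊔ S.devices] D) {B : Set E} (hB : MeasurableSet B) :
    S.P x (D ∩ S.X (n + 1) ⁻¹' B) = ∫⁻ ω in D, Q (S.X n ω) B ∂S.P x := by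
  have := S.isProbabilityMeasure x
  have hle : S.past n ⊔ S.devices ≤ mΩ := sup_le (S.past_le n) S.devices_le
  have hXB := S.measurable_X (n + 1) hB
  have hm : Measurable[S.past n] fun ω => Q (S.X n ω) B :=
    (Q.measurable_coe hB).comp (S.measurable_X_past le_rfl)
  have hind : Indep (MeasurableSpace.comap (fun ω k => S.X k ω) inferInstance) S.devices (S.P x) :=
    S.indep_X_ξ x
  -- On a rectangle `a ∩ b` the factor `b` splits off from both sides by independence, since all
  -- else is a function of the path of `X`.
  have key : ∀ a b, MeasurableSet[S.past n] a → MeasurableSet[S.devices] b →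
      S.P x (a ∩ b ∩ S.X (n + 1) ⁻¹' B) = ∫⁻ ω in a ∩ b, Q (S.X n ω) B ∂S.P x := by
    intro a b ha hb
    have h1 : S.P x (a ∩ S.X (n + 1) ⁻¹' B ∩ b) = S.P x (a ∩ S.X (n + 1) ⁻¹' B) * S.P x b := by
      refine (Indep_iff _ _ _).1 hind _ _
        (MeasurableSet.inter (S.past_le_comap_paths n a ha) ?_) hb
      exact S.past_le_comap_paths (n + 1) _ (S.measurable_X_past le_rfl hB)
    rw [Set.inter_right_comm, h1, S.measure_past_inter x n ha hB]
    have h2 := lintegral_mul_eq_lintegral_mul_lintegral_of_independent_measurableSpace (μ := S.P x)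
      (S.past_le n) S.devices_le (indep_of_indep_of_le_left hind (S.past_le_comap_paths n))
      (hm.indicator ha) (measurable_const.indicator hb : Measurable[S.devices]
        (b.indicator fun _ => (1 : ENNReal)))
    simp only [lintegral_indicator (S.past_le n a ha), lintegral_indicator (S.devices_le b hb),
      lintegral_const, one_mul, Measure.restrict_apply_univ] at h2
    rw [← h2, ← lintegral_indicator ((S.past_le n a ha).inter (S.devices_le b hb))]
    congr 1 with ω
    by_cases h3 : ω ∈ a <;> by_cases h4 : ω ∈ b <;> simp [h3, h4]
  -- Both sides, as functions of `D`, are measures. The rectangles generate only `past n ⊔ devices`,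
  -- so uniqueness applies after trimming to this σ-algebra.
  let μ₁ : Measure[S.past n ⊔ S.devices] Ω := ((S.P x).restrict (S.X (n + 1) ⁻¹' B)).trim hle
  let μ₂ : Measure[S.past n ⊔ S.devices] Ω :=
    ((S.P x).withDensity fun ω => Q (S.X n ω) B).trim hle
  have h1 : ∀ D, MeasurableSet[S.past n ⊔ S.devices] D →
      μ₁ D = S.P x (D ∩ S.X (n + 1) ⁻¹' B) := fun D hD => by
    rw [trim_measurableSet_eq hle hD, Measure.restrict_apply (hle D hD)]
  have h2 : ∀ D, MeasurableSet[S.past n ⊔ S.devices] D →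
      μ₂ D = ∫⁻ ω in D, Q (S.X n ω) B ∂S.P x := fun D hD => by
    rw [trim_measurableSet_eq hle hD, withDensity_apply _ (hle D hD)]
  rw [← h1 D hD, ← h2 D hD]
  have heq : ∀ a b, MeasurableSet[S.past n] a → MeasurableSet[S.devices] b →
      μ₁ (a ∩ b) = μ₂ (a ∩ b) := fun a b ha hb => by
    have hab : MeasurableSet[S.past n ⊔ S.devices] (a ∩ b) := by
      rw [sup_eq_generateFrom_inter]
      exact MeasurableSpace.measurableSet_generateFrom ⟨a, b, ha, hb, rfl⟩
    rw [h1 _ hab, h2 _ hab, key a b ha hb]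
  have : IsFiniteMeasure μ₁ := isFiniteMeasure_trim hle
  refine congrArg (fun ν : Measure[S.past n ⊔ S.devices] Ω => ν D) (ext_of_generate_finite _
    (sup_eq_generateFrom_inter _ _) (isPiSystem_inter_measurableSet _ _) ?_ ?_)
  · rintro _ ⟨a, b, ha, hb, rfl⟩
    exact heq a b ha hb
  · simpa using heq Set.univ Set.univ MeasurableSet.univ MeasurableSet.univ

/-- As an identity of measures, the Markov property passes directly to integrals of unbounded `V`.
-/
lemma map_X_succ_restrict [IsMarkovKernel Q] (S : Setting Ω Q α) (x : E) (n : ℕ) {D : Set Ω}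
    (hD : MeasurableSet[S.past n ⊔ S.devices] D) :
    Q ∘ₘ (((S.P x).restrict D).map (S.X n)) = ((S.P x).restrict D).map (S.X (n + 1)) := by
  have hD' := sup_le (S.past_le n) S.devices_le D hD
  ext B hB
  rw [Measure.bind_apply hB Q.aemeasurable, lintegral_map (Q.measurable_coe hB) (S.measurable_X n),
    Measure.map_apply (S.measurable_X _) hB, Measure.restrict_apply (S.measurable_X _ hB),
    Set.inter_comm, S.measure_inter_eq_lintegral x n hD hB]

lemma _root_.MeasureTheory.Integrable.integral_measure_comp {A B : Type*} [MeasurableSpace A]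
    [MeasurableSpace B] {κ : Kernel A B} [IsSFiniteKernel κ] {μ : Measure A} [SFinite μ]
    {V : B → ℝ} (h : Integrable V (κ ∘ₘ μ)) : ∫ y, V y ∂(κ ∘ₘ μ) = ∫ a, ∫ y, V y ∂κ a ∂μ := by
  rw [Measure.comp_eq_comp_const_apply] at h ⊢
  simpa using Kernel.integral_comp h

lemma setIntegral_X_succ [IsMarkovKernel Q] (S : Setting Ω Q α) (x : E) (n : ℕ) {D : Set Ω}
    (hD : MeasurableSet[S.past n ⊔ S.devices] D) {V : E → ℝ} (hV : Measurable V)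
    (hi : Integrable (fun ω => V (S.X (n + 1) ω)) (S.P x)) :
    ∫ ω in D, V (S.X (n + 1) ω) ∂S.P x = ∫ ω in D, ∫ y, V y ∂Q (S.X n ω) ∂S.P x := by
  have := S.isProbabilityMeasure x
  have h1 : Integrable V (Q ∘ₘ (((S.P x).restrict D).map (S.X n))) := by
    rw [S.map_X_succ_restrict x n hD]
    exact (integrable_map_measure hV.aestronglyMeasurable (S.measurable_X _).aemeasurable).2
      hi.restrict
  have h2 := h1.integral_measure_comp
  rw [S.map_X_succ_restrict x n hD, integral_map (S.measurable_X _).aemeasurable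
    hV.aestronglyMeasurable, integral_map (S.measurable_X _).aemeasurable] at h2
  · exact h2
  · exact (hV.stronglyMeasurable.integral_kernel).aestronglyMeasurable

lemma integrable_integral_X [IsMarkovKernel Q] (S : Setting Ω Q α) (x : E) (n : ℕ)
    {V : E → ℝ} (hV : Measurable V) (hi : Integrable (fun ω => V (S.X (n + 1) ω)) (S.P x)) :
    Integrable (fun ω => ∫ y, V y ∂Q (S.X n ω)) (S.P x) := by
  have h0 := S.map_X_succ_restrict x n (D := Set.univ) MeasurableSet.univ
  rw [Measure.restrict_univ] at h0
  have h1 : Integrable V (Q ∘ₘ ((S.P x).map (S.X n))) := by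
    rw [h0]
    exact (integrable_map_measure hV.aestronglyMeasurable (S.measurable_X _).aemeasurable).2 hi
  have h2 : Integrable (fun y => ∫ z, ‖V z‖ ∂Q y) ((S.P x).map (S.X n)) :=
    Measure.integrable_integral_norm_of_integrable_comp h1
  refine (h2.comp_measurable (S.measurable_X n)).mono' ?_
    (ae_of_all _ fun ω => norm_integral_le_integral_norm _)
  exact (hV.stronglyMeasurable.integral_kernel.comp_measurable
    (S.measurable_X n)).aestronglyMeasurable

/-- The law of `X_1` under `P x` is `Q x`. -/
lemma map_X_one [IsMarkovKernel Q] (S : Setting Ω Q α) (x : E) : (S.P x).map (S.X 1) = Q x := by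
  have h := S.map_X_succ_restrict x 0 (D := Set.univ) MeasurableSet.univ
  rw [Measure.restrict_univ, S.initial x] at h
  rw [← h, Measure.dirac_bind Q.measurable]

/-! ### Independence and uniformity of a single device -/

lemma indepFun_others (S : Setting Ω Q α) (x : E) (j : Fin 2) (n : ℕ) :
    IndepFun (S.others j n) (S.ξ j n) (S.P x) := by
  have := S.isProbabilityMeasure x
  let R : Ω → ({q : Fin 2 × ℕ // q ≠ (j, n)} → ℝ) := fun ω q => S.ξ q.1.1 q.1.2 ω
  let T : Ω → ℕ → E := fun ω k => S.X k ω
  have hR : Measurable R := measurable_pi_lambda _ fun q => S.measurable_ξ q.1.1 q.1.2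
  have hRξ : IndepFun R (S.ξ j n) (S.P x) := by
    have h := indep_iSup_of_disjoint (m := fun q : Fin 2 × ℕ =>
      MeasurableSpace.comap (S.ξ q.1 q.2) inferInstance)
      (fun q => (S.measurable_ξ q.1 q.2).comap_le) (S.indep_ξ x)
      (S := {q | q ≠ (j, n)}) (T := {(j, n)}) (by simp)
    refine indep_of_indep_of_le_left (indep_of_indep_of_le_right h ?_) ?_
    · simp
    · refine Measurable.comap_le (@measurable_pi_lambda _ _ _ (_) _ _ fun q => ?_)
      refine Measurable.mono (comap_measurable _) ?_ le_rfl
      exact le_iSup₂ (f := fun q (_ : q ∈ {q | q ≠ (j, n)}) =>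
        MeasurableSpace.comap (S.ξ q.1 q.2) inferInstance) q.1 q.2
  have hT : IndepFun T (fun ω => (R ω, S.ξ j n ω)) (S.P x) :=
    (S.indep_X_ξ x).comp (φ := id) (ψ := fun v : Fin 2 × ℕ → ℝ =>
      ((fun q => v q.1 : {q : Fin 2 × ℕ // q ≠ (j, n)} → ℝ), v (j, n))) measurable_id (by fun_prop)
  have hTR : IndepFun T R (S.P x) := hT.comp measurable_id measurable_fst
  have hξ := S.measurable_ξ j n
  have hTm : Measurable T := S.measurable_paths
  rw [indepFun_iff_map_prod_eq_prod_map_map (S.measurable_others j n).aemeasurable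
    hξ.aemeasurable]
  have e1 := hT.map_prod_eq_prod_map_map hTm.aemeasurable (hR.prodMk hξ).aemeasurable
  rw [hRξ.map_prod_eq_prod_map_map hR.aemeasurable hξ.aemeasurable] at e1
  have e2 := hTR.map_prod_eq_prod_map_map hTm.aemeasurable hR.aemeasurable
  change Measure.map (fun ω => ((T ω, R ω), S.ξ j n ω)) _ =
    (Measure.map (fun ω => (T ω, R ω)) _).prod _
  have := Measure.isProbabilityMeasure_map (μ := S.P x) hξ.aemeasurable
  have := Measure.isProbabilityMeasure_map (μ := S.P x) hR.aemeasurable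
  have := Measure.isProbabilityMeasure_map (μ := S.P x) hTm.aemeasurable
  rw [e2]
  -- Independence is known for `T` against `(R, ξ)` and for `R` against `ξ`. Associativity of the
  -- product measure regroups this as `(T, R)` against `ξ`.
  apply (MeasurableEquiv.map_measurableEquiv_injective MeasurableEquiv.prodAssoc)
  rw [Measure.prodAssoc_prod, ← e1, Measure.map_map (MeasurableEquiv.measurable _)
    ((hTm.prodMk hR).prodMk hξ)]
  rfl

lemma measure_device_le (S : Setting Ω Q α) (x : E) (j : Fin 2) (n : ℕ) {c : ℝ}
    (hc : c ∈ Set.Icc (0 : ℝ) 1) : ((S.P x).map (S.ξ j n)).real (Set.Iic c) = c := by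
  have h : (S.P x).map (S.ξ j n) = cond volume (Set.Ioo 0 1) := S.uniform_ξ x j n
  -- Adding the null endpoint `1` makes the intersection with `Iic c` equal to `Ioc 0 c` even for `c
  -- = 1`.
  rw [h, Measure.real, cond_apply measurableSet_Ioo, measure_congr
    ((Ioo_ae_eq_Ioc (μ := volume) (a := (0 : ℝ)) (b := 1)).inter (ae_eq_refl (Set.Iic c)))]
  rw [Set.Ioc_inter_Iic, min_eq_right hc.2]
  simp [hc.1]

/-- Given the path and the other devices, `ξ^j_n` is still uniform, so it falls below `p(X_n)` with
conditional probability `p(X_n)`. The proof is Fubini for the product law of `others` and `ξ^j_n`.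
-/
lemma setIntegral_device_le (S : Setting Ω Q α) (x : E) (j : Fin 2) (n : ℕ) {D : Set Ω}
    (hD : MeasurableSet[MeasurableSpace.comap (S.others j n) inferInstance] D) {p k : E → ℝ}
    (hp : IsStrategy p) (hk : Measurable k) (hi : Integrable (fun ω => k (S.X n ω)) (S.P x)) :
    ∫ ω in D ∩ {ω | S.ξ j n ω ≤ p (S.X n ω)}, k (S.X n ω) ∂S.P x =
      ∫ ω in D, p (S.X n ω) * k (S.X n ω) ∂S.P x := by
  have := S.isProbabilityMeasure x
  have hξ := S.measurable_ξ j n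
  have hO := S.measurable_others j n
  have := Measure.isProbabilityMeasure_map (μ := S.P x) hξ.aemeasurable
  obtain ⟨D', hD', rfl⟩ := hD
  let Φ : ((ℕ → E) × ({q : Fin 2 × ℕ // q ≠ (j, n)} → ℝ)) × ℝ → ℝ :=
    {z | z.1 ∈ D' ∧ z.2 ≤ p (z.1.1 n)}.indicator fun z => k (z.1.1 n)
  have hX : Measurable fun z : ((ℕ → E) × ({q : Fin 2 × ℕ // q ≠ (j, n)} → ℝ)) × ℝ => z.1.1 n :=
    by fun_prop
  have hS : MeasurableSet {z : ((ℕ → E) × ({q : Fin 2 × ℕ // q ≠ (j, n)} → ℝ)) × ℝ |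
      z.1 ∈ D' ∧ z.2 ≤ p (z.1.1 n)} :=
    (measurable_fst hD').inter (measurableSet_le measurable_snd (hp.1.comp hX))
  have hΦ : Measurable Φ := (hk.comp hX).indicator hS
  have hΨ : Measurable fun ω => (S.others j n ω, S.ξ j n ω) := hO.prodMk hξ
  have hmap := (S.indepFun_others x j n).map_prod_eq_prod_map_map hO.aemeasurable hξ.aemeasurable
  have hset : MeasurableSet {ω | S.ξ j n ω ≤ p (S.X n ω)} :=
    measurableSet_le hξ (hp.1.comp (S.measurable_X n))
  have e1 : (fun ω => Φ (S.others j n ω, S.ξ j n ω)) =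
      (S.others j n ⁻¹' D' ∩ {ω | S.ξ j n ω ≤ p (S.X n ω)}).indicator fun ω => k (S.X n ω) := rfl
  have hint : Integrable Φ (((S.P x).map (S.others j n)).prod ((S.P x).map (S.ξ j n))) := by
    rw [← hmap, integrable_map_measure hΦ.aestronglyMeasurable hΨ.aemeasurable]
    exact hi.indicator ((hO hD').inter hset)
  rw [← integral_indicator ((hO hD').inter hset), ← e1,
    ← integral_map hΨ.aemeasurable hΦ.aestronglyMeasurable, hmap, integral_prod _ hint,
    integral_map hO.aemeasurable, ← integral_indicator (hO hD')]
  · congr 1 with ω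
    by_cases hω : S.others j n ω ∈ D'
    · rw [Set.indicator_of_mem (by exact hω)]
      have : (fun u => Φ (S.others j n ω, u)) =
          (Set.Iic (p (S.X n ω))).indicator fun _ => k (S.X n ω) := by
        ext u
        by_cases hu : u ≤ p (S.X n ω)
        · rw [Set.indicator_of_mem (by exact hu)]
          exact Set.indicator_of_mem (s := {z : _ × ℝ | z.1 ∈ D' ∧ z.2 ≤ p (z.1.1 n)})
            (by exact ⟨hω, hu⟩) _
        · rw [Set.indicator_of_notMem (by exact hu)]
          exact Set.indicator_of_notMem (s := {z : _ × ℝ | z.1 ∈ D' ∧ z.2 ≤ p (z.1.1 n)})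
            (fun h => hu h.2) _
      rw [this, integral_indicator_const _ measurableSet_Iic, S.measure_device_le x j n (hp.2 _),
        smul_eq_mul]
    · rw [Set.indicator_of_notMem (by exact hω)]
      have : (fun u => Φ (S.others j n ω, u)) = fun _ => 0 := by
        ext u
        simp [Φ, hω]
      rw [this, integral_zero]
  · exact (hΦ.stronglyMeasurable.integral_prod_right'
      (ν := (S.P x).map (S.ξ j n))).aestronglyMeasurable

/-! ### Killing versus discounting: domination and decay -/

lemma enorm_killed (S : Setting Ω Q α) (u : E → ℝ) (n : ℕ) (ω : Ω) :
    ‖(S.killed n ω).elim 0 u‖ₑ = if n < S.ζ ω then ‖u (S.X n ω)‖ₑ else 0 := by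
  unfold killed
  split_ifs <;> simp

lemma survival_lintegral (S : Setting Ω Q α) (x : E) (n : ℕ) :
    ∫⁻ k, (if n < k then 1 else 0) ∂(S.P x).map S.ζ = ENNReal.ofReal (α ^ n) := by
  rw [lintegral_map (.of_discrete) S.measurable_ζ, ← S.survival x n, ← lintegral_indicator_one]
  · refine lintegral_congr fun ω => ?_
    by_cases hn : n < S.ζ ω
    · rw [Set.indicator_of_mem (by exact hn)]
      simp [hn]
    · rw [Set.indicator_of_notMem (by exact hn)]
      simp [hn]
  · exact S.measurable_ζ (.of_discrete (s := {k | n < k}))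

lemma lintegral_killed (S : Setting Ω Q α) (x : E) {u : E → ℝ} (hu : Measurable u) (n : ℕ) :
    ∫⁻ ω, ‖(S.killed n ω).elim 0 u‖ₑ ∂S.P x =
      ENNReal.ofReal (α ^ n) * ∫⁻ ω, ‖u (S.X n ω)‖ₑ ∂S.P x := by
  have hm1 : Measurable fun k : ℕ => if n < k then (1 : ENNReal) else 0 := .of_discrete
  have hm2 : Measurable fun y : ℕ → E => ‖u (y n)‖ₑ := by fun_prop
  have h := lintegral_mul_eq_lintegral_mul_lintegral_of_indepFun
    (hm2.comp S.measurable_paths) (hm1.comp S.measurable_ζ) ((S.indep_X_ζ x).comp hm2 hm1)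
  rw [← S.survival_lintegral x n, lintegral_map hm1 S.measurable_ζ, mul_comm]
  refine Eq.trans (lintegral_congr fun ω => ?_) h
  rw [S.enorm_killed]
  by_cases hn : n < S.ζ ω <;> simp [hn]

/-- The discounted payoffs are dominated by an integrable random variable. -/
lemma lintegral_iSup_discounted (S : Setting Ω Q α) (hα : 0 ≤ α) {u : E → ℝ} (hu : Measurable u)
    (hint : S.SupIntegrable u) (x : E) :
    ∫⁻ ω, ⨆ n, ‖α ^ n * u (S.X n ω)‖ₑ ∂S.P x < ⊤ := by
  have := S.isProbabilityMeasure x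
  refine lt_of_le_of_lt ?_ (hint x)
  have hX := S.measurable_paths
  have hζ := S.measurable_ζ
  have := Measure.isProbabilityMeasure_map (μ := S.P x) hζ.aemeasurable
  have hmap := (S.indep_X_ζ x).map_prod_eq_prod_map_map hX.aemeasurable hζ.aemeasurable
  have hm : Measurable fun z : (ℕ → E) × ℕ => ⨆ n, if n < z.2 then ‖u (z.1 n)‖ₑ else 0 := by
    refine Measurable.iSup fun n => Measurable.ite ?_ ?_ measurable_const
    · exact measurable_snd (.of_discrete (s := {k | n < k}))
    · fun_prop
  calc ∫⁻ ω, ⨆ n, ‖α ^ n * u (S.X n ω)‖ₑ ∂S.P x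
      = ∫⁻ y : ℕ → E, ⨆ n, ‖α ^ n * u (y n)‖ₑ ∂(S.P x).map fun ω n => S.X n ω := by
        rw [lintegral_map (by fun_prop) hX]
    _ ≤ ∫⁻ y : ℕ → E, ∫⁻ k, (⨆ n, if n < k then ‖u (y n)‖ₑ else 0) ∂(S.P x).map S.ζ
          ∂(S.P x).map fun ω n => S.X n ω := by
        -- For a fixed path `y`, `α^n |u(y_n)|` is the mean over `ζ` of `|u(y_n)|` on `{n < ζ}`, and
        -- a supremum of means is at most the mean of the supremum.
        refine lintegral_mono fun y => le_trans (iSup_mono fun n => ?_) (iSup_lintegral_le _)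
        rw [enorm_mul, Real.enorm_of_nonneg (pow_nonneg hα n), ← S.survival_lintegral x n,
          ← lintegral_mul_const _ .of_discrete]
        refine lintegral_mono fun k => ?_
        split_ifs <;> simp
    _ = ∫⁻ ω, ⨆ n, ‖(S.killed n ω).elim 0 u‖ₑ ∂S.P x := by
        rw [← lintegral_prod _ hm.aemeasurable, ← hmap, lintegral_map hm (hX.prodMk hζ)]
        simp only [S.enorm_killed]

/-- The discounted supremum that dominates the payoffs. -/
def envelope (S : Setting Ω Q α) (u : E → ℝ) (ω : Ω) : ℝ :=
  (⨆ n, ‖α ^ n * u (S.X n ω)‖ₑ).toReal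

lemma integrable_envelope (S : Setting Ω Q α) (hα : 0 ≤ α) {u : E → ℝ} (hu : Measurable u)
    (hint : S.SupIntegrable u) (x : E) : Integrable (S.envelope u) (S.P x) := by
  have hX := S.measurable_X
  exact integrable_toReal_of_lintegral_ne_top (by fun_prop)
    (S.lintegral_iSup_discounted hα hu hint x).ne

lemma ae_abs_le_envelope (S : Setting Ω Q α) (hα : 0 ≤ α) {u : E → ℝ} (hu : Measurable u)
    (hint : S.SupIntegrable u) (x : E) :
    ∀ᵐ ω ∂S.P x, ∀ n, |α ^ n * u (S.X n ω)| ≤ S.envelope u ω := by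
  have hX := S.measurable_X
  filter_upwards [ae_lt_top (by fun_prop) (S.lintegral_iSup_discounted hα hu hint x).ne]
    with ω hω n
  have h := ENNReal.toReal_mono hω.ne (le_iSup (fun n => ‖α ^ n * u (S.X n ω)‖ₑ) n)
  simp only [toReal_enorm, Real.norm_eq_abs] at h
  exact h

lemma integrable_comp_X (S : Setting Ω Q α) (hα : 0 < α) {u : E → ℝ} (hu : Measurable u)
    (hint : S.SupIntegrable u) (x : E) (n : ℕ) : Integrable (fun ω => u (S.X n ω)) (S.P x) := by
  have h : Integrable (fun ω => α ^ n * u (S.X n ω)) (S.P x) :=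
    (S.integrable_envelope hα.le hu hint x).mono'
      ((hu.comp (S.measurable_X n)).const_mul _).aestronglyMeasurable
      ((S.ae_abs_le_envelope hα.le hu hint x).mono fun ω h => h n)
  refine (h.const_mul (α ^ n)⁻¹).congr (ae_of_all _ fun ω => ?_)
  have : α ^ n ≠ 0 := (pow_pos hα n).ne'
  simp only []
  field_simp

lemma integrable_kernel [IsMarkovKernel Q] (S : Setting Ω Q α) (hα : 0 < α) {u : E → ℝ}
    (hu : Measurable u) (hint : S.SupIntegrable u) (x : E) : Integrable u (Q x) := by
  rw [← S.map_X_one x, integrable_map_measure hu.aestronglyMeasurable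
    (S.measurable_X 1).aemeasurable]
  exact S.integrable_comp_X hα hu hint x 1

/-- The mean at date `n` equals that of the killed process. As `ζ` is finite, every killed path ends
in the cemetery, and the integrable supremum dominates. -/
lemma tendsto_lintegral_discounted (S : Setting Ω Q α) (hα : 0 ≤ α) {u : E → ℝ}
    (hu : Measurable u) (hint : S.SupIntegrable u) (x : E) :
    Tendsto (fun n => ∫⁻ ω, ‖α ^ n * u (S.X n ω)‖ₑ ∂S.P x) atTop (𝓝 0) := by
  have h : ∀ n, ∫⁻ ω, ‖α ^ n * u (S.X n ω)‖ₑ ∂S.P x =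
      ∫⁻ ω, ‖(S.killed n ω).elim 0 u‖ₑ ∂S.P x := fun n => by
    have hX := S.measurable_X
    rw [S.lintegral_killed x hu, ← lintegral_const_mul _ (by fun_prop)]
    simp only [enorm_mul, Real.enorm_of_nonneg (pow_nonneg hα n)]
  simp only [h]
  rw [← lintegral_zero (μ := S.P x)]
  refine tendsto_lintegral_of_dominated_convergence
    (fun ω => ⨆ n, ‖(S.killed n ω).elim 0 u‖ₑ) (fun n => ?_)
    (fun n => ae_of_all _ fun ω => le_iSup (fun n => ‖(S.killed n ω).elim 0 u‖ₑ) n)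
    (hint x).ne (ae_of_all _ fun ω => ?_)
  · simp only [S.enorm_killed]
    have hX := S.measurable_X
    exact Measurable.ite (S.measurable_ζ (.of_discrete (s := {k | n < k}))) (by fun_prop)
      measurable_const
  · refine tendsto_const_nhds.congr' ?_
    filter_upwards [eventually_ge_atTop (S.ζ ω)] with n hn
    simp [S.enorm_killed, not_lt.2 hn]

lemma tendsto_integral_discounted (S : Setting Ω Q α) (hα : 0 ≤ α) {u : E → ℝ}
    (hu : Measurable u) (hint : S.SupIntegrable u) (x : E) (D : ℕ → Set Ω) :
    Tendsto (fun n => ∫ ω in D n, α ^ n * u (S.X n ω) ∂S.P x) atTop (𝓝 0) := by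
  refine tendsto_zero_iff_enorm_tendsto_zero.2 (tendsto_of_tendsto_of_tendsto_of_le_of_le
    tendsto_const_nhds (S.tendsto_lintegral_discounted hα hu hint x) (fun _ => zero_le)
    fun n => ?_)
  exact (enorm_integral_le_lintegral_enorm _).trans (setLIntegral_le_lintegral _ _)

lemma SupIntegrable.of_abs_le (S : Setting Ω Q α) {f g h V : E → ℝ} (hf : S.SupIntegrable f)
    (hg : S.SupIntegrable g) (hh : S.SupIntegrable h) (hfm : Measurable f) (hgm : Measurable g)
    (hV : ∀ x, |V x| ≤ |f x| + |g x| + |h x|) : S.SupIntegrable V := by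
  intro x
  have hm : ∀ u : E → ℝ, Measurable u →
      Measurable fun ω => ⨆ n, ‖(S.killed n ω).elim 0 u‖ₑ := fun u hu => by
    simp only [S.enorm_killed]
    have hX := S.measurable_X
    exact Measurable.iSup fun n => Measurable.ite
      (S.measurable_ζ (.of_discrete (s := {k | n < k}))) (by fun_prop) measurable_const
  have hlt := ENNReal.add_lt_top.2 ⟨ENNReal.add_lt_top.2 ⟨hf x, hg x⟩, hh x⟩
  rw [← lintegral_add_left (hm f hfm), ← lintegral_add_left ((hm f hfm).fun_add (hm g hgm))] at hlt
  refine lt_of_le_of_lt (lintegral_mono fun ω => iSup_le fun n => ?_) hlt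
  refine le_trans ?_ (add_le_add (add_le_add
    (le_iSup (fun n => ‖(S.killed n ω).elim 0 f‖ₑ) n)
    (le_iSup (fun n => ‖(S.killed n ω).elim 0 g‖ₑ) n))
    (le_iSup (fun n => ‖(S.killed n ω).elim 0 h‖ₑ) n))
  simp only [S.enorm_killed]
  split_ifs
  · simp only [Real.enorm_eq_ofReal_abs]
    rw [← ENNReal.ofReal_add (abs_nonneg _) (abs_nonneg _),
      ← ENNReal.ofReal_add (by positivity) (abs_nonneg _)]
    exact ENNReal.ofReal_le_ofReal (hV _)
  · exact zero_le


/-! ### Measurability of Markovian stopping times -/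

section SubAlgebra

variable {E Ω : Type*} {m : MeasurableSpace Ω} [MeasurableSpace E] [mΩ : MeasurableSpace Ω]
  {Q : Kernel E E} {α : ℝ}

lemma _root_.WithTop.natCast_add_one_le_iff_lt {n : ℕ} {t : WithTop ℕ} :
    ((n + 1 : ℕ) : WithTop ℕ) ≤ t ↔ (n : WithTop ℕ) < t := by
  induction t using WithTop.recTopCoe with
  | top => exact ⟨fun _ => WithTop.coe_lt_top n, fun _ => le_top⟩
  | coe t =>
    change ((n + 1 : ℕ) : WithTop ℕ) ≤ (t : ℕ) ↔ (n : WithTop ℕ) < (t : ℕ)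
    rw [Nat.cast_le, Nat.cast_lt, Nat.succ_le_iff]

lemma le_markovTime_iff (S : Setting Ω Q α) (j : Fin 2) (p : E → ℝ) (ω : Ω) (n : ℕ) :
    (n : WithTop ℕ) ≤ S.markovTime j p ω ↔ ∀ k < n, p (S.X k ω) < S.ξ j k ω := by
  unfold markovTime
  split_ifs with h
  · rw [Nat.cast_le]
    constructor
    · intro hn k hk
      by_contra hc
      exact absurd (Nat.sInf_le (s := {n : ℕ | p (S.X n ω) ≥ S.ξ j n ω}) (by exact not_lt.1 hc))
        (by omega)
    · intro hk
      by_contra hc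
      have : p (S.X _ ω) ≥ S.ξ j _ ω := Nat.sInf_mem (s := {n : ℕ | p (S.X n ω) ≥ S.ξ j n ω}) h
      exact absurd (hk _ (not_le.1 hc)) (not_lt.2 this)
  · push Not at h
    simpa using fun k _ => h k

lemma info_le_of (S : Setting Ω Q α) (i : Fin 2) (n : ℕ)
    (hX : ∀ k ≤ n, Measurable[m] (S.X k)) (hξ : ∀ k ≤ n, Measurable[m] (S.ξ i k)) :
    S.info i n ≤ m :=
  iSup₂_le fun k hk => sup_le (hX k hk).comap_le (hξ k hk).comap_le

/-- Only devices of dates strictly before `n` matter, so the event is measurable even for the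
σ-algebra that omits `ξ^j_n`. This is why `m` is left arbitrary. -/
lemma measurableSet_le_markovTime (S : Setting Ω Q α) (j : Fin 2) {p : E → ℝ} (hp : Measurable p)
    (n : ℕ) (hX : ∀ k < n, Measurable[m] (S.X k))
    (hξ : ∀ k < n, Measurable[m] (S.ξ j k)) :
    MeasurableSet[m] {ω | (n : WithTop ℕ) ≤ S.markovTime j p ω} := by
  have : {ω | (n : WithTop ℕ) ≤ S.markovTime j p ω} =
      ⋂ k, ⋂ (_ : k < n), {ω | p (S.X k ω) < S.ξ j k ω} := by
    ext ω
    simp [S.le_markovTime_iff]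
  rw [this]
  exact MeasurableSet.iInter fun k => MeasurableSet.iInter fun hk =>
    measurableSet_lt (hp.comp (hX k hk)) (hξ k hk)

end SubAlgebra

lemma lt_markovTime_iff (S : Setting Ω Q α) (j : Fin 2) (p : E → ℝ) (ω : Ω) (n : ℕ) :
    (n : WithTop ℕ) < S.markovTime j p ω ↔
      (n : WithTop ℕ) ≤ S.markovTime j p ω ∧ ¬ S.ξ j n ω ≤ p (S.X n ω) := by
  rw [← WithTop.natCast_add_one_le_iff_lt, S.le_markovTime_iff, S.le_markovTime_iff, not_le]
  constructor
  · exact fun h => ⟨fun k hk => h k (by omega), h n (by omega)⟩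
  · rintro ⟨h1, h2⟩ k hk
    rcases Nat.lt_succ_iff_lt_or_eq.1 hk with hk | rfl
    exacts [h1 k hk, h2]

lemma measurable_X_info (S : Setting Ω Q α) (i : Fin 2) {k n : ℕ} (h : k ≤ n) :
    Measurable[S.info i n] (S.X k) :=
  Measurable.mono (comap_measurable _) (le_sup_left.trans (le_iSup₂ (f := fun k (_ : k ≤ n) =>
    MeasurableSpace.comap (S.X k) inferInstance ⊔
      MeasurableSpace.comap (S.ξ i k) inferInstance) k h)) le_rfl

lemma measurable_ξ_info (S : Setting Ω Q α) (i : Fin 2) {k n : ℕ} (h : k ≤ n) :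
    Measurable[S.info i n] (S.ξ i k) :=
  Measurable.mono (comap_measurable _) (le_sup_right.trans (le_iSup₂ (f := fun k (_ : k ≤ n) =>
    MeasurableSpace.comap (S.X k) inferInstance ⊔
      MeasurableSpace.comap (S.ξ i k) inferInstance) k h)) le_rfl

lemma markovTime_mem_admissible (S : Setting Ω Q α) (j : Fin 2) {p : E → ℝ} (hp : Measurable p) :
    S.markovTime j p ∈ S.Admissible j := by
  intro n
  have h := S.measurableSet_le_markovTime j hp (n + 1) (m := S.info j n)
    (fun k hk => S.measurable_X_info j (by omega)) (fun k hk => S.measurable_ξ_info j (by omega))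
  convert h.compl using 1
  ext ω
  rw [Set.mem_compl_iff, Set.mem_ofPred_eq, Set.mem_ofPred_eq, WithTop.natCast_add_one_le_iff_lt,
    not_lt]
  rfl

lemma measurable_X_others (S : Setting Ω Q α) (j : Fin 2) (n k : ℕ) :
    Measurable[MeasurableSpace.comap (S.others j n) inferInstance] (S.X k) :=
  ((measurable_pi_apply k).comp measurable_fst).comp (comap_measurable (S.others j n))

lemma measurable_ξ_others (S : Setting Ω Q α) {j i : Fin 2} {n k : ℕ} (h : (i, k) ≠ (j, n)) :
    Measurable[MeasurableSpace.comap (S.others j n) inferInstance] (S.ξ i k) :=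
  ((measurable_pi_apply (⟨(i, k), h⟩ : {q : Fin 2 × ℕ // q ≠ (j, n)})).comp
    measurable_snd).comp (comap_measurable (S.others j n))

lemma measurable_ξ_devices (S : Setting Ω Q α) (i : Fin 2) (k : ℕ) :
    Measurable[S.devices] (S.ξ i k) :=
  (measurable_pi_apply (i, k)).comp
    (comap_measurable fun ω (q : Fin 2 × ℕ) => S.ξ q.1 q.2 ω)

/-! ### The one-step inequality and the verification theorem -/

lemma setIntegral_device_gt (S : Setting Ω Q α) (x : E) (j : Fin 2) (n : ℕ) {D : Set Ω}
    (hD : MeasurableSet[MeasurableSpace.comap (S.others j n) inferInstance] D) {p k : E → ℝ}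
    (hp : IsStrategy p) (hk : Measurable k) (hi : Integrable (fun ω => k (S.X n ω)) (S.P x)) :
    ∫ ω in D \ {ω | S.ξ j n ω ≤ p (S.X n ω)}, k (S.X n ω) ∂S.P x =
      ∫ ω in D, (1 - p (S.X n ω)) * k (S.X n ω) ∂S.P x := by
  have hset : MeasurableSet {ω | S.ξ j n ω ≤ p (S.X n ω)} :=
    measurableSet_le (S.measurable_ξ j n) (hp.1.comp (S.measurable_X n))
  have h1 := integral_inter_add_sdiff (μ := S.P x) (s := D) hset hi.integrableOn
  rw [S.setIntegral_device_le x j n hD hp hk hi] at h1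
  have hpi : Integrable (fun ω => p (S.X n ω) * k (S.X n ω)) (S.P x) :=
    hi.bdd_mul (c := 1) (hp.1.comp (S.measurable_X n)).aestronglyMeasurable
      (ae_of_all _ fun ω => by
        rw [Real.norm_of_nonneg (hp.2 _).1]
        exact (hp.2 _).2)
  simp only [sub_mul, one_mul]
  rw [integral_sub hi.restrict hpi.restrict, ← h1]
  ring

/-- Neither player has stopped before date `n`. -/
def running (τ σ : Ω → WithTop ℕ) (n : ℕ) : Set Ω := {ω | (n : WithTop ℕ) ≤ τ ω ∧ n ≤ σ ω}

/-- The payoff collected before date `n` grows by the payoff of stopping at date `n`. -/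
lemma indicator_reward_succ (S : Setting Ω Q α) (f g h p : E → ℝ) (j : Fin 2) (τ : Ω → WithTop ℕ)
    (n : ℕ) (ω : Ω) :
    (running τ (S.markovTime j p) (n + 1))ᶜ.indicator (S.reward f g h τ (S.markovTime j p)) ω =
      (running τ (S.markovTime j p) n)ᶜ.indicator (S.reward f g h τ (S.markovTime j p)) ω +
      α ^ n * (({ω | τ ω = n ∧ (n : WithTop ℕ) ≤ S.markovTime j p ω} ∩
          {ω | S.ξ j n ω ≤ p (S.X n ω)}).indicator (fun ω => h (S.X n ω)) ω +
        ({ω | τ ω = n ∧ (n : WithTop ℕ) ≤ S.markovTime j p ω} \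
          {ω | S.ξ j n ω ≤ p (S.X n ω)}).indicator (fun ω => f (S.X n ω)) ω +
        ({ω | n < τ ω ∧ (n : WithTop ℕ) ≤ S.markovTime j p ω} ∩
          {ω | S.ξ j n ω ≤ p (S.X n ω)}).indicator (fun ω => g (S.X n ω)) ω) := by
  classical
  have h1 := S.lt_markovTime_iff j p ω n
  have h2 := WithTop.natCast_add_one_le_iff_lt (n := n) (t := S.markovTime j p ω)
  have h3 := WithTop.natCast_add_one_le_iff_lt (n := n) (t := τ ω)
  generalize hσ : S.markovTime j p = σ at *
  simp only [Set.indicator_apply, running, Set.mem_compl_iff, Set.mem_ofPred_eq, Set.mem_inter_iff,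
    Set.mem_sdiff, h2, h3]
  by_cases hs : (n : WithTop ℕ) ≤ σ ω
  swap
  · have : ¬ (n : WithTop ℕ) < σ ω := fun h => hs h.le
    simp [hs, this]
  by_cases hξ : S.ξ j n ω ≤ p (S.X n ω)
  · have hσn : σ ω = n := le_antisymm (not_lt.1 fun h => (h1.1 h).2 hξ) hs
    rcases lt_trichotomy (n : WithTop ℕ) (τ ω) with ht | ht | ht
    · simp [hσn, ht, ht.le, ht.ne', ht.not_gt, hξ, reward]
      rfl
    · simp [hσn, ← ht, hξ, reward]
      rfl
    · simp [hσn, ht.not_ge, ht.not_gt, ht.ne]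
  · have hσn : (n : WithTop ℕ) < σ ω := h1.2 ⟨hs, hξ⟩
    rcases lt_trichotomy (n : WithTop ℕ) (τ ω) with ht | ht | ht
    · simp [hσn, ht, ht.le, ht.ne', hσn.le, hξ]
    · simp [hσn, ← ht, hξ, reward, hσn.le]
      rfl
    · simp [ht.not_ge, ht.not_gt, ht.ne]

/-- The supermartingale step. Averaging over `ξ^j_n` turns the payoffs of date `n` into mixtures
with weights `p` and `1 - p`: of `h` and `f` if `τ` stops at `n`, of `g` and `αΠV` if it does not.
-/
lemma setIntegral_payoff_le [IsMarkovKernel Q] (S : Setting Ω Q α) (x : E) (n : ℕ)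
    {i j : Fin 2} (hij : i ≠ j) {f g h V p : E → ℝ}
    (hf : Measurable f) (hg : Measurable g) (hh : Measurable h) (hV : Measurable V)
    (hfi : Integrable (fun ω => f (S.X n ω)) (S.P x))
    (hgi : Integrable (fun ω => g (S.X n ω)) (S.P x))
    (hhi : Integrable (fun ω => h (S.X n ω)) (S.P x))
    (hVi : ∀ n, Integrable (fun ω => V (S.X n ω)) (S.P x))
    (hp : IsStrategy p) (h_now : ∀ x, p x * h x + (1 - p x) * f x ≤ V x)
    (h_later : ∀ x, p x * g x + (1 - p x) * contVal Q α V x ≤ V x)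
    {τ : Ω → WithTop ℕ} (hτ : τ ∈ S.Admissible i) :
    ∫ ω in {ω | τ ω = n ∧ (n : WithTop ℕ) ≤ S.markovTime j p ω} ∩
          {ω | S.ξ j n ω ≤ p (S.X n ω)}, h (S.X n ω) ∂S.P x +
      ∫ ω in {ω | τ ω = n ∧ (n : WithTop ℕ) ≤ S.markovTime j p ω} \
          {ω | S.ξ j n ω ≤ p (S.X n ω)}, f (S.X n ω) ∂S.P x +
      ∫ ω in {ω | n < τ ω ∧ (n : WithTop ℕ) ≤ S.markovTime j p ω} ∩
          {ω | S.ξ j n ω ≤ p (S.X n ω)}, g (S.X n ω) ∂S.P x +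
      α * ∫ ω in running τ (S.markovTime j p) (n + 1), V (S.X (n + 1) ω) ∂S.P x ≤
    ∫ ω in running τ (S.markovTime j p) n, V (S.X n ω) ∂S.P x := by
  have := S.isProbabilityMeasure x
  set B := {ω | τ ω = n ∧ (n : WithTop ℕ) ≤ S.markovTime j p ω} with hB
  set C := {ω | n < τ ω ∧ (n : WithTop ℕ) ≤ S.markovTime j p ω} with hC
  set T := {ω | S.ξ j n ω ≤ p (S.X n ω)} with hT
  have hA' : running τ (S.markovTime j p) (n + 1) = C \ T := by
    ext ω
    simp only [running, Set.mem_ofPred_eq, WithTop.natCast_add_one_le_iff_lt, hC, hT, Set.mem_sdiff,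
      S.lt_markovTime_iff j p ω n]
    tauto
  have hA : running τ (S.markovTime j p) n = B ∪ C := by
    ext ω
    simp only [running, Set.mem_ofPred_eq, hB, hC, Set.mem_union, le_iff_eq_or_lt (b := τ ω),
      eq_comm (b := τ ω)]
    tauto
  have hdisj : Disjoint B C := Set.disjoint_left.2 fun ω h1 h2 => by
    have h3 : (n : WithTop ℕ) < τ ω := h2.1
    rw [show τ ω = n from h1.1] at h3
    exact lt_irrefl _ h3
  have hst : IsStoppingTime (S.info i) τ := hτ
  -- Since `i ≠ j`, the opponent never observes `ξ^j_n`.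
  have hinfo : S.info i n ≤ MeasurableSpace.comap (S.others j n) inferInstance :=
    S.info_le_of i n (fun k _ => S.measurable_X_others j n k)
      (fun k _ => S.measurable_ξ_others fun h => hij (congrArg Prod.fst h))
  have hσ : MeasurableSet[MeasurableSpace.comap (S.others j n) inferInstance]
      {ω | (n : WithTop ℕ) ≤ S.markovTime j p ω} :=
    S.measurableSet_le_markovTime j hp.1 n (fun k _ => S.measurable_X_others j n k)
      (fun k hk => S.measurable_ξ_others fun h => hk.ne (congrArg Prod.snd h))
  have hBo : MeasurableSet[MeasurableSpace.comap (S.others j n) inferInstance] B :=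
    MeasurableSet.inter (hinfo _ (hst.measurableSet_eq n)) hσ
  have hCo : MeasurableSet[MeasurableSpace.comap (S.others j n) inferInstance] C :=
    MeasurableSet.inter (hinfo _ (hst.measurableSet_gt n)) hσ
  have hXp : ∀ k ≤ n, Measurable[S.past n ⊔ S.devices] (S.X k) := fun k hk =>
    (S.measurable_X_past hk).mono le_sup_left le_rfl
  have hξp : ∀ i k, Measurable[S.past n ⊔ S.devices] (S.ξ i k) := fun i k =>
    (S.measurable_ξ_devices i k).mono le_sup_right le_rfl
  -- The event of continuing does involve `ξ^j_n`, hence the need for a Markov property relative to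
  -- all devices.
  have hD : MeasurableSet[S.past n ⊔ S.devices] (C \ T) := by
    refine MeasurableSet.diff (MeasurableSet.inter ?_ ?_) ?_
    · exact S.info_le_of i n hXp (fun k _ => hξp i k) _ (hst.measurableSet_gt n)
    · exact S.measurableSet_le_markovTime j hp.1 n (fun k hk => hXp k hk.le) (fun k _ => hξp j k)
    · exact measurableSet_le (hξp j n) (hp.1.comp (hXp n le_rfl))
  have hCm : Measurable fun y => ∫ z, V z ∂Q y :=
    hV.stronglyMeasurable.integral_kernel.measurable
  have hCi := S.integrable_integral_X x n hV (hVi (n + 1))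
  have hpm : AEStronglyMeasurable (fun ω => p (S.X n ω)) (S.P x) :=
    (hp.1.comp (S.measurable_X n)).aestronglyMeasurable
  have hpi : ∀ {k : Ω → ℝ}, Integrable k (S.P x) →
      Integrable (fun ω => p (S.X n ω) * k ω) (S.P x) := fun hk =>
    hk.bdd_mul (c := 1) hpm (ae_of_all _ fun ω => by
      rw [Real.norm_of_nonneg (hp.2 _).1]
      exact (hp.2 _).2)
  have hqi : ∀ {k : Ω → ℝ}, Integrable k (S.P x) →
      Integrable (fun ω => (1 - p (S.X n ω)) * k ω) (S.P x) := fun hk => by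
    simp only [sub_mul, one_mul]
    exact hk.sub (hpi hk)
  rw [hA', hA, setIntegral_union hdisj ((S.measurable_others j n).comap_le _ hCo)
    (hVi n).integrableOn (hVi n).integrableOn, S.setIntegral_X_succ x n hD hV (hVi (n + 1)),
    S.setIntegral_device_gt x j n hCo hp hCm hCi, S.setIntegral_device_le x j n hBo hp hh hhi,
    S.setIntegral_device_gt x j n hBo hp hf hfi, S.setIntegral_device_le x j n hCo hp hg hgi,
    ← integral_const_mul, ← integral_add (hpi hhi).restrict (hqi hfi).restrict, add_assoc,
    ← integral_add (hpi hgi).restrict ((hqi hCi).const_mul α).restrict]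
  -- The remaining inequalities are `h_now` integrated over `B` and `h_later` integrated over `C`.
  refine add_le_add ?_ ?_
  · exact integral_mono ((hpi hhi).add (hqi hfi)).restrict (hVi n).restrict fun ω => h_now _
  · refine integral_mono ((hpi hgi).add ((hqi hCi).const_mul α)).restrict (hVi n).restrict
      fun ω => ?_
    have := h_later (S.X n ω)
    unfold contVal at this
    simp only []
    linarith

/-- Verification: a player cannot obtain more than `V` against a Markovian strategy `p` for which
`V` dominates the values of stopping and of continuing. -/
theorem integral_reward_le [IsMarkovKernel Q] (S : Setting Ω Q α) (hα : 0 < α)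
    {i j : Fin 2} (hij : i ≠ j) {f g h V p : E → ℝ}
    (hf : Measurable f) (hg : Measurable g) (hh : Measurable h) (hV : Measurable V)
    (hfs : S.SupIntegrable f) (hgs : S.SupIntegrable g) (hhs : S.SupIntegrable h)
    (hVs : S.SupIntegrable V)
    (hp : IsStrategy p) (h_now : ∀ x, p x * h x + (1 - p x) * f x ≤ V x)
    (h_later : ∀ x, p x * g x + (1 - p x) * contVal Q α V x ≤ V x)
    {τ : Ω → WithTop ℕ} (hτ : τ ∈ S.Admissible i) (x : E) :
    ∫ ω, S.reward f g h τ (S.markovTime j p) ω ∂S.P x ≤ V x := by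
  have := S.isProbabilityMeasure x
  set σ := S.markovTime j p with hσ
  set A := running τ σ with hA
  let Z : ℕ → Ω → ℝ := fun n => (A n)ᶜ.indicator (S.reward f g h τ σ)
  have hst : IsStoppingTime (S.info i) τ := hτ
  have hσs : IsStoppingTime (S.info j) σ := S.markovTime_mem_admissible j hp.1
  have hle : ∀ n : ℕ, MeasurableSet {ω | (n : WithTop ℕ) ≤ σ ω} := fun n =>
    (S.info j).le n _ (hσs.measurableSet_ge n)
  have hB : ∀ n : ℕ, MeasurableSet {ω | τ ω = n ∧ (n : WithTop ℕ) ≤ σ ω} := fun n =>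
    ((S.info i).le n _ (hst.measurableSet_eq n)).inter (hle n)
  have hC : ∀ n : ℕ, MeasurableSet {ω | n < τ ω ∧ (n : WithTop ℕ) ≤ σ ω} := fun n =>
    ((S.info i).le n _ (hst.measurableSet_gt n)).inter (hle n)
  have hT : ∀ n, MeasurableSet {ω | S.ξ j n ω ≤ p (S.X n ω)} := fun n =>
    measurableSet_le (S.measurable_ξ j n) (hp.1.comp (S.measurable_X n))
  have hfi := S.integrable_comp_X hα hf hfs x
  have hgi := S.integrable_comp_X hα hg hgs x
  have hhi := S.integrable_comp_X hα hh hhs x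
  have hVi := S.integrable_comp_X hα hV hVs x
  have hZs : ∀ n, Z (n + 1) = _ := fun n => funext (S.indicator_reward_succ f g h p j τ n)
  have hA0 : A 0 = Set.univ := by
    ext ω
    simp [hA, running]
  have hZ0 : Z 0 = 0 := by
    ext ω
    simp [Z, hA0]
  have hinc : ∀ n : ℕ, Integrable (fun ω =>
      (({ω | τ ω = n ∧ (n : WithTop ℕ) ≤ σ ω} ∩
          {ω | S.ξ j n ω ≤ p (S.X n ω)}).indicator (fun ω => h (S.X n ω)) ω +
        ({ω | τ ω = n ∧ (n : WithTop ℕ) ≤ σ ω} \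
          {ω | S.ξ j n ω ≤ p (S.X n ω)}).indicator (fun ω => f (S.X n ω)) ω +
        ({ω | n < τ ω ∧ (n : WithTop ℕ) ≤ σ ω} ∩
          {ω | S.ξ j n ω ≤ p (S.X n ω)}).indicator (fun ω => g (S.X n ω)) ω)) (S.P x) := fun n =>
    (((hhi n).indicator ((hB n).inter (hT n))).add
      ((hfi n).indicator ((hB n).diff (hT n)))).add ((hgi n).indicator ((hC n).inter (hT n)))
  have hZi : ∀ n, Integrable (Z n) (S.P x) := by
    intro n
    induction n with
    | zero => rw [hZ0]; exact integrable_zero _ _ _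
    | succ n ih =>
      rw [hZs]
      exact ih.add ((hinc n).const_mul _)
  -- The mean of the payoff collected before date `n`, plus the discounted `V` as the price of the
  -- game still running.
  let c : ℕ → ℝ := fun n => ∫ ω, Z n ω ∂S.P x + ∫ ω in A n, α ^ n * V (S.X n ω) ∂S.P x
  have hanti : Antitone c := by
    refine antitone_nat_of_succ_le fun n => ?_
    have h1 := S.setIntegral_payoff_le x n hij hf hg hh hV (hfi n) (hgi n) (hhi n) hVi hp h_now
      h_later hτ
    have h2 : ∫ ω, Z (n + 1) ω ∂S.P x = ∫ ω, Z n ω ∂S.P x + α ^ n *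
        (∫ ω in {ω | τ ω = n ∧ (n : WithTop ℕ) ≤ σ ω} ∩ {ω | S.ξ j n ω ≤ p (S.X n ω)},
            h (S.X n ω) ∂S.P x +
          ∫ ω in {ω | τ ω = n ∧ (n : WithTop ℕ) ≤ σ ω} \ {ω | S.ξ j n ω ≤ p (S.X n ω)},
            f (S.X n ω) ∂S.P x +
          ∫ ω in {ω | n < τ ω ∧ (n : WithTop ℕ) ≤ σ ω} ∩ {ω | S.ξ j n ω ≤ p (S.X n ω)},
            g (S.X n ω) ∂S.P x) := by
      rw [hZs, integral_add (hZi n) ((hinc n).const_mul _), integral_const_mul,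
        integral_add (((hhi n).indicator ((hB n).inter (hT n))).fun_add
          ((hfi n).indicator ((hB n).diff (hT n)))) ((hgi n).indicator ((hC n).inter (hT n))),
        integral_add ((hhi n).indicator ((hB n).inter (hT n)))
          ((hfi n).indicator ((hB n).diff (hT n))),
        integral_indicator ((hB n).inter (hT n)), integral_indicator ((hB n).diff (hT n)),
        integral_indicator ((hC n).inter (hT n))]
    have h3 := mul_le_mul_of_nonneg_left h1 (pow_nonneg hα.le n)
    simp only [c, h2, integral_const_mul, pow_succ]
    rw [← hσ] at h3
    linarith
  have hev : ∀ ω, ∀ᶠ n in atTop, Z n ω = S.reward f g h τ σ ω := by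
    intro ω
    -- If nobody ever stops, the indicator always vanishes, which agrees with the reward `0`;
    -- otherwise the game is over from some date on.
    by_cases hω : τ ω = ⊤ ∧ σ ω = ⊤
    · refine Eventually.of_forall fun n => ?_
      have : S.reward f g h τ σ ω = 0 := by simp [reward, hω.1, hω.2]
      simp [Z, this]
    · have : ∃ N : ℕ, τ ω < N ∨ σ ω < N := by
        rw [not_and_or] at hω
        rcases hω with hω | hω
        · obtain ⟨m, hm⟩ := WithTop.ne_top_iff_exists.1 hω
          exact ⟨m + 1, Or.inl (by rw [← hm]; exact WithTop.coe_lt_coe.2 (Nat.lt_succ_self m))⟩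
        · obtain ⟨m, hm⟩ := WithTop.ne_top_iff_exists.1 hω
          exact ⟨m + 1, Or.inr (by rw [← hm]; exact WithTop.coe_lt_coe.2 (Nat.lt_succ_self m))⟩
      obtain ⟨N, hN⟩ := this
      filter_upwards [eventually_ge_atTop N] with n hn
      have hn' : (N : WithTop ℕ) ≤ n := by exact_mod_cast hn
      refine Set.indicator_of_mem (fun hmem => ?_) _
      rcases hN with hN | hN
      · exact absurd (hN.trans_le hn') (not_lt.2 hmem.1)
      · exact absurd (hN.trans_le hn') (not_lt.2 hmem.2)
  have hbound : ∀ n, ∀ᵐ ω ∂S.P x,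
      ‖Z n ω‖ ≤ S.envelope f ω + S.envelope g ω + S.envelope h ω := by
    intro n
    filter_upwards [S.ae_abs_le_envelope hα.le hf hfs x, S.ae_abs_le_envelope hα.le hg hgs x,
      S.ae_abs_le_envelope hα.le hh hhs x] with ω h1 h2 h3
    have e1 := (abs_nonneg _).trans (h1 0)
    have e2 := (abs_nonneg _).trans (h2 0)
    have e3 := (abs_nonneg _).trans (h3 0)
    refine (norm_indicator_le_norm_self _ _).trans ?_
    rw [Real.norm_eq_abs]
    unfold reward
    split_ifs
    · linarith [h1 ((τ ω).untopD 0)]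
    · linarith [h2 ((σ ω).untopD 0)]
    · linarith [h3 ((τ ω).untopD 0)]
    · rw [abs_zero]; positivity
  have hlim : Tendsto c atTop (𝓝 (∫ ω, S.reward f g h τ σ ω ∂S.P x + 0)) := by
    refine Tendsto.add ?_ (S.tendsto_integral_discounted hα.le hV hVs x A)
    exact tendsto_integral_of_dominated_convergence _ (fun n => (hZi n).aestronglyMeasurable)
      (((S.integrable_envelope hα.le hf hfs x).add (S.integrable_envelope hα.le hg hgs x)).add
        (S.integrable_envelope hα.le hh hhs x)) hbound
      (ae_of_all _ fun ω => tendsto_const_nhds.congr' ((hev ω).mono fun n hn => hn.symm))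
  rw [add_zero] at hlim
  have hc0 : c 0 = V x := by
    simp only [c, hZ0, hA0, pow_zero, one_mul, Measure.restrict_univ, Pi.zero_apply,
      integral_zero, zero_add]
    rw [← integral_map (S.measurable_X 0).aemeasurable hV.aestronglyMeasurable, S.initial x,
      integral_dirac' _ _ hV.stronglyMeasurable]
  rw [← hc0]
  exact le_of_tendsto hlim (Eventually.of_forall fun n => hanti (Nat.zero_le n))

end Setting

/-! ### The median, the operator `step` and its monotone iteration -/

lemma med_of_le {a c : ℝ} (h : a ≤ c) (b : ℝ) : med a b c = max a (min b c) := by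
  unfold med
  grind

lemma med_comm (a b c : ℝ) : med a b c = med c b a := by
  unfold med
  rw [max_comm a b, max_comm a c, max_comm b c, min_left_comm, min_comm (max b a),
    ← min_assoc, min_comm (max c a), min_assoc, min_comm (max c a)]

lemma le_and_le_of_eq_med {a b c : ℝ} (hac : a ≤ c) (h : b = med a b c) : a ≤ b ∧ b ≤ c := by
  rw [med_of_le hac] at h
  constructor
  · rw [h]; exact le_max_left _ _
  · rw [h]; exact max_le hac (min_le_right _ _)

section Iteration

variable {E : Type*} [MeasurableSpace E] {Q : Kernel E E} {α : ℝ} {f g h : E → ℝ}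

lemma step_of_lt {x : E} (hx : f x < g x) (W : E → ℝ) :
    step Q α f g h W x = max (f x) (min (contVal Q α W x) (g x)) := by
  rw [step, if_pos hx, med_of_le hx.le]

lemma step_of_le {x : E} (hx : g x ≤ f x) (W : E → ℝ) : step Q α f g h W x = h x := by
  rw [step, if_neg hx.not_gt]

/-- On `{f < g}` the median lies between `f` and `g`. The bound does not depend on `W`, so it covers
all later iterates and every solution of the fixed-point equation. -/
lemma abs_step_le (W : E → ℝ) (x : E) : |step Q α f g h W x| ≤ |f x| + |g x| + |h x| := by
  rcases lt_or_ge (f x) (g x) with hx | hx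
  · rw [step_of_lt hx, abs_le]
    have h1 := le_max_left (f x) (min (contVal Q α W x) (g x))
    have h2 : max (f x) (min (contVal Q α W x) (g x)) ≤ g x := max_le hx.le (min_le_right _ _)
    have := neg_abs_le (f x)
    have := le_abs_self (g x)
    have := abs_nonneg (f x)
    have := abs_nonneg (g x)
    have := abs_nonneg (h x)
    constructor <;> linarith
  · rw [step_of_le hx]
    have := abs_nonneg (f x)
    have := abs_nonneg (g x)
    linarith

lemma abs_iter_le (n : ℕ) (x : E) : |iter Q α f g h n x| ≤ |f x| + |g x| + |h x| := by
  cases n with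
  | zero =>
    have := abs_nonneg (f x)
    have := abs_nonneg (g x)
    have := abs_nonneg (h x)
    rcases min_choice (f x) (h x) with h1 | h1 <;> simp only [iter, h1] <;> linarith
  | succ n => exact abs_step_le _ x

lemma measurable_contVal {W : E → ℝ} (hW : Measurable W) : Measurable (contVal Q α W) :=
  (hW.stronglyMeasurable.integral_kernel.measurable).const_mul α

lemma measurable_step (hf : Measurable f) (hg : Measurable g) (hh : Measurable h) {W : E → ℝ}
    (hW : Measurable W) : Measurable (step Q α f g h W) := by
  have := measurable_contVal (Q := Q) (α := α) hW
  refine Measurable.ite (measurableSet_lt hf hg) ?_ hh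
  unfold med
  fun_prop

lemma measurable_iter (hf : Measurable f) (hg : Measurable g) (hh : Measurable h) (n : ℕ) :
    Measurable (iter Q α f g h n) := by
  induction n with
  | zero => exact hf.min hh
  | succ n ih => exact measurable_step hf hg hh ih

lemma contVal_mono (hα : 0 ≤ α) {W W' : E → ℝ} {x : E} (hW : Integrable W (Q x))
    (hW' : Integrable W' (Q x)) (hle : ∀ y, W y ≤ W' y) : contVal Q α W x ≤ contVal Q α W' x :=
  mul_le_mul_of_nonneg_left (integral_mono hW hW' hle) hα

lemma contVal_neg (V : E → ℝ) (x : E) : contVal Q α (-V) x = -contVal Q α V x := by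
  simp [contVal, integral_neg]

lemma integrable_of_abs_le_payoffs {x : E} (hfi : Integrable f (Q x)) (hgi : Integrable g (Q x))
    (hhi : Integrable h (Q x)) {V : E → ℝ} (hV : Measurable V)
    (hle : ∀ x, |V x| ≤ |f x| + |g x| + |h x|) : Integrable V (Q x) :=
  ((hfi.abs.add hgi.abs).add hhi.abs).mono' hV.aestronglyMeasurable (ae_of_all _ hle)

/-- `f ∧ h` lies below any value of `step`, which is at least `f` where `f < g` and equals `h`
elsewhere. Monotonicity of the integral propagates this. -/
lemma iter_mono (hα : 0 ≤ α)
    (hint : ∀ n x, Integrable (iter Q α f g h n) (Q x)) (x : E) :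
    Monotone fun n => iter Q α f g h n x := by
  suffices H : ∀ n x, iter Q α f g h n x ≤ iter Q α f g h (n + 1) x from
    monotone_nat_of_le_succ fun n => H n x
  intro n
  induction n with
  | zero =>
    intro x
    change min (f x) (h x) ≤ step Q α f g h _ x
    rcases lt_or_ge (f x) (g x) with hx | hx
    · rw [step_of_lt hx]
      exact (min_le_left _ _).trans (le_max_left _ _)
    · rw [step_of_le hx]
      exact min_le_right _ _
  | succ n ih =>
    intro x
    change step Q α f g h (iter Q α f g h n) x ≤ step Q α f g h (iter Q α f g h (n + 1)) x
    rcases lt_or_ge (f x) (g x) with hx | hx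
    · rw [step_of_lt hx, step_of_lt hx]
      exact max_le_max le_rfl (min_le_min (contVal_mono hα (hint n x) (hint (n + 1) x) ih) le_rfl)
    · rw [step_of_le hx, step_of_le hx]

/-- The iteration started at `f ∧ h` increases to a fixed point of `step`. -/
theorem exists_fixedPoint (hα : 0 ≤ α) (hf : Measurable f) (hg : Measurable g) (hh : Measurable h)
    (hfi : ∀ x, Integrable f (Q x)) (hgi : ∀ x, Integrable g (Q x))
    (hhi : ∀ x, Integrable h (Q x)) :
    ∃ V : E → ℝ, Measurable V ∧ (∀ x, Integrable V (Q x)) ∧ (∀ x, V x = step Q α f g h V x) ∧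
      (∀ n, Measurable (iter Q α f g h n)) ∧
      (∀ n x, Integrable (iter Q α f g h n) (Q x)) ∧
      (∀ x, Monotone fun n => iter Q α f g h n x) ∧
      (∀ x, Tendsto (fun n => iter Q α f g h (n + 1) x) atTop (𝓝 (V x))) := by
  have hm := measurable_iter (Q := Q) (α := α) hf hg hh
  have hi : ∀ n x, Integrable (iter Q α f g h n) (Q x) := fun n x =>
    integrable_of_abs_le_payoffs (hfi x) (hgi x) (hhi x) (hm n) (abs_iter_le n)
  have hmono := iter_mono hα hi
  have hlim : ∀ x, Tendsto (fun n => iter Q α f g h n x) atTop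
      (𝓝 (⨆ n, iter Q α f g h n x)) := fun x =>
    tendsto_atTop_ciSup (hmono x) ⟨|f x| + |g x| + |h x|, by
      rintro _ ⟨n, rfl⟩
      exact (le_abs_self _).trans (abs_iter_le n x)⟩
  set V : E → ℝ := fun x => ⨆ n, iter Q α f g h n x
  have hVm : Measurable V := measurable_of_tendsto_metrizable hm (tendsto_pi_nhds.2 hlim)
  have hVb : ∀ x, |V x| ≤ |f x| + |g x| + |h x| := fun x =>
    le_of_tendsto (hlim x).abs (Eventually.of_forall fun n => abs_iter_le n x)
  have hsucc : ∀ x, Tendsto (fun n => iter Q α f g h (n + 1) x) atTop (𝓝 (V x)) := fun x =>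
    (hlim x).comp (tendsto_add_atTop_nat 1)
  refine ⟨V, hVm, fun x => integrable_of_abs_le_payoffs (hfi x) (hgi x) (hhi x) hVm hVb,
    fun x => ?_, hm, hi, hmono, hsucc⟩
  have hc : Tendsto (fun n => contVal Q α (iter Q α f g h n) x) atTop (𝓝 (contVal Q α V x)) := by
    refine Tendsto.const_mul α ?_
    exact tendsto_integral_of_dominated_convergence (fun y => |f y| + |g y| + |h y|)
      (fun n => (hm n).aestronglyMeasurable) (((hfi x).abs.add (hgi x).abs).add (hhi x).abs)
      (fun n => ae_of_all _ (abs_iter_le n)) (ae_of_all _ hlim)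
  -- At each point `step` is a continuous function of the continuation value alone, so the limit
  -- passes through it.
  refine tendsto_nhds_unique (hsucc x) ?_
  change Tendsto (fun n => step Q α f g h (iter Q α f g h n) x) atTop (𝓝 (step Q α f g h V x))
  rcases lt_or_ge (f x) (g x) with hx | hx
  · simp only [step_of_lt hx]
    exact tendsto_const_nhds.max (hc.min tendsto_const_nhds)
  · simp only [step_of_le hx]
    exact tendsto_const_nhds

end Iteration

/-! ### The inequalities contained in the nine-case rule -/

section NineCase

variable {E : Type*} [MeasurableSpace E] {Q : Kernel E E} {α : ℝ} {f g h V p₁ p₂ : E → ℝ}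

/-- These are the hypotheses `h_now` and `h_later` of `integral_reward_le` for `p₂`. The second
player must not stop where `αΠV < g` and `f < g`, and must stop wherever waiting would give the
first player more than `V`. -/
lemma NineCaseRule.upper (hR : NineCaseRule Q α f g V p₁ p₂) (hp : IsStrategy p₂)
    (hmid : ∀ x, h x = med (f x) (h x) (g x)) (hV : ∀ x, V x = step Q α f g h V x) (x : E) :
    p₂ x * h x + (1 - p₂ x) * f x ≤ V x ∧
      p₂ x * g x + (1 - p₂ x) * contVal Q α V x ≤ V x := by
  obtain ⟨h0, h1⟩ := hp.2 x
  have h1' : 0 ≤ 1 - p₂ x := by linarith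
  rcases lt_or_ge (f x) (g x) with hx | hx
  · have hVx := hV x
    rw [step_of_lt hx] at hVx
    obtain ⟨hfh, hhg⟩ := le_and_le_of_eq_med hx.le (hmid x)
    rcases lt_or_ge (contVal Q α V x) (g x) with hc | hc
    · have hp0 : p₂ x = 0 := by
        rcases lt_trichotomy (f x) (contVal Q α V x) with h2 | h2 | h2
        · exact (hR.vii x hx h2 hc).2
        · exact hR.viii x hx h2
        · exact (hR.ix x hx h2).2
      rw [min_eq_left hc.le] at hVx
      rw [hp0, hVx]
      simp
    · rw [min_eq_right hc, max_eq_right hx.le] at hVx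
      rw [hVx]
      refine ⟨by nlinarith, ?_⟩
      rcases eq_or_lt_of_le hc with h2 | h2
      · rw [← h2]; linarith
      · rw [(hR.v x hx h2).2]; linarith
  · have hVx := hV x
    rw [step_of_le hx] at hVx
    have hmid' := hmid x
    rw [med_comm] at hmid'
    obtain ⟨hgh, hhf⟩ := le_and_le_of_eq_med hx hmid'
    rcases eq_or_lt_of_le hx with h2 | h2
    · have hfV : f x = V x := by linarith
      have hgV : g x = V x := by linarith
      rw [hfV, hgV, ← hVx]
      refine ⟨by linarith, ?_⟩
      rcases le_or_gt (contVal Q α V x) (V x) with h3 | h3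
      · nlinarith
      · rw [hR.iv x h2.symm h3]; linarith
    · rw [(hR.i x h2).2, hVx]
      constructor <;> linarith

/-- The mirror image of `NineCaseRule.upper` under `(f, g, h, V) ↦ (-g, -f, -h, -V)` with the
players exchanged. -/
lemma NineCaseRule.lower (hR : NineCaseRule Q α f g V p₁ p₂) (hp : IsStrategy p₁)
    (hmid : ∀ x, h x = med (f x) (h x) (g x)) (hV : ∀ x, V x = step Q α f g h V x) (x : E) :
    V x ≤ p₁ x * h x + (1 - p₁ x) * g x ∧
      V x ≤ p₁ x * f x + (1 - p₁ x) * contVal Q α V x := by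
  obtain ⟨h0, h1⟩ := hp.2 x
  have h1' : 0 ≤ 1 - p₁ x := by linarith
  rcases lt_or_ge (f x) (g x) with hx | hx
  · have hVx := hV x
    rw [step_of_lt hx] at hVx
    obtain ⟨hfh, hhg⟩ := le_and_le_of_eq_med hx.le (hmid x)
    rcases lt_or_ge (f x) (contVal Q α V x) with hc | hc
    · have hp0 : p₁ x = 0 := by
        rcases lt_trichotomy (g x) (contVal Q α V x) with h2 | h2 | h2
        · exact (hR.v x hx h2).1
        · exact hR.vi x hx h2
        · exact (hR.vii x hx hc h2).1
      rw [max_eq_right (le_min hc.le hx.le)] at hVx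
      rw [hp0, hVx]
      simp
    · rw [min_eq_left (hc.trans hx.le), max_eq_left hc] at hVx
      rw [hVx]
      refine ⟨by nlinarith, ?_⟩
      rcases eq_or_lt_of_le hc with h2 | h2
      · rw [h2]; linarith
      · rw [(hR.ix x hx h2).1]; linarith
  · have hVx := hV x
    rw [step_of_le hx] at hVx
    have hmid' := hmid x
    rw [med_comm] at hmid'
    obtain ⟨hgh, hhf⟩ := le_and_le_of_eq_med hx hmid'
    rcases eq_or_lt_of_le hx with h2 | h2
    · have hfV : f x = V x := by linarith
      have hgV : g x = V x := by linarith
      rw [hfV, hgV, ← hVx]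
      refine ⟨by linarith, ?_⟩
      rcases le_or_gt (V x) (contVal Q α V x) with h3 | h3
      · nlinarith
      · rw [hR.ii x h2.symm h3]; linarith
    · rw [(hR.i x h2).1, hVx]
      constructor <;> linarith

/-- Every measurable function admits pure strategies that obey the nine-case rule. -/
lemma exists_pure_nineCaseRule (hf : Measurable f) (hg : Measurable g) (hV : Measurable V) :
    ∃ p₁ p₂ : E → ℝ, IsStrategy p₁ ∧ IsStrategy p₂ ∧ IsPure p₁ ∧ IsPure p₂ ∧
      NineCaseRule Q α f g V p₁ p₂ := by
  classical
  have hc := measurable_contVal (Q := Q) (α := α) hV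
  have hpure : ∀ A : Set E, IsPure (A.indicator fun _ => (1 : ℝ)) := fun A x => by
    by_cases hx : x ∈ A <;> simp [hx]
  have hstrat : ∀ A : Set E, MeasurableSet A → IsStrategy (A.indicator fun _ => (1 : ℝ)) :=
    fun A hA => ⟨measurable_const.indicator hA, fun x => by
      rcases hpure A x with h | h <;> rw [h] <;> simp⟩
  -- Both players stop on `{g ≤ f}`, which settles (i)–(iv) at once. Elsewhere each stops only where
  -- waiting is strictly worse, so the ties (vi) and (viii) give `0`.
  refine ⟨_, _, hstrat ({x | g x ≤ f x} ∪ {x | contVal Q α V x < f x})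
      ((measurableSet_le hg hf).union (measurableSet_lt hc hf)),
    hstrat ({x | g x ≤ f x} ∪ {x | g x < contVal Q α V x})
      ((measurableSet_le hg hf).union (measurableSet_lt hg hc)), hpure _, hpure _, ?_⟩
  constructor <;> intro x <;>
    simp only [Set.indicator_apply, Set.mem_union, Set.mem_ofPred_eq] <;> intros <;> grind

end NineCase

/-! ### From the two bounds to the equilibrium -/

namespace Setting

variable {E Ω : Type*} [MeasurableSpace E] [mΩ : MeasurableSpace Ω] {Q : Kernel E E} {α : ℝ}

lemma reward_neg (S : Setting Ω Q α) (f g h : E → ℝ) (τ σ : Ω → WithTop ℕ) (ω : Ω) :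
    S.reward (-g) (-f) (-h) σ τ ω = -S.reward f g h τ σ ω := by
  unfold reward
  rcases lt_trichotomy (τ ω) (σ ω) with h1 | h1 | h1
  · simp [h1, h1.not_gt]
  · by_cases h2 : σ ω < ⊤ <;> simp [h1, h2]
  · simp [h1, h1.not_gt]

lemma J₂_zeroSum (S : Setting Ω Q α) (f g h : E → ℝ) (x : E) (τ₁ τ₂ : Ω → WithTop ℕ) :
    S.J₂ (Payoffs.zeroSum f g h) x τ₁ τ₂ = -S.J₁ (Payoffs.zeroSum f g h) x τ₁ τ₂ := by
  simp only [J₁, J₂, Payoffs.zeroSum, Matrix.cons_val_zero, Matrix.cons_val_one]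
  rw [← integral_neg]
  exact integral_congr_ae (ae_of_all _ fun ω => S.reward_neg f g h τ₁ τ₂ ω)

/-- Strategies that obey the nine-case rule for a fixed point of `step` form an equilibrium. -/
theorem isGlobalEquilibrium_of_nineCaseRule [IsMarkovKernel Q] (S : Setting Ω Q α) (hα : 0 < α)
    {f g h V p₁ p₂ : E → ℝ} (hf : Measurable f) (hg : Measurable g) (hh : Measurable h)
    (hint : S.IntegrablePayoffs (Payoffs.zeroSum f g h))
    (hmid : ∀ x, h x = med (f x) (h x) (g x)) (hVm : Measurable V)
    (hV : ∀ x, V x = step Q α f g h V x) (hp₁ : IsStrategy p₁) (hp₂ : IsStrategy p₂)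
    (hR : NineCaseRule Q α f g V p₁ p₂) :
    S.IsGlobalEquilibrium (Payoffs.zeroSum f g h) p₁ p₂ ∧
      S.HasValue (Payoffs.zeroSum f g h) p₁ p₂ V := by
  obtain ⟨hfs, hgs, hhs⟩ : S.SupIntegrable f ∧ S.SupIntegrable g ∧ S.SupIntegrable h := hint 0
  obtain ⟨hgs', hfs', hhs'⟩ :
    S.SupIntegrable (-g) ∧ S.SupIntegrable (-f) ∧ S.SupIntegrable (-h) := hint 1
  have hVb : ∀ x, |V x| ≤ |f x| + |g x| + |h x| := fun x => by
    rw [hV x]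
    exact abs_step_le V x
  have hVs : S.SupIntegrable V := .of_abs_le S hfs hgs hhs hf hg hVb
  have hVs' : S.SupIntegrable (-V) := .of_abs_le S hfs hgs hhs hf hg (by simpa using hVb)
  have hup : ∀ x, ∀ τ ∈ S.Admissible 0,
      S.J₁ (Payoffs.zeroSum f g h) x τ (S.markovTime 1 p₂) ≤ V x := fun x τ hτ =>
    S.integral_reward_le hα (by decide) hf hg hh hVm hfs hgs hhs hVs hp₂
      (fun x => (hR.upper hp₂ hmid hV x).1) (fun x => (hR.upper hp₂ hmid hV x).2) hτ x
  have hlow : ∀ x, ∀ τ ∈ S.Admissible 1,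
      S.J₂ (Payoffs.zeroSum f g h) x (S.markovTime 0 p₁) τ ≤ -V x := fun x τ hτ =>
    -- The second player maximizes in the game `(-g, -f, -h)`: the payoff for stopping first is
    -- `-g`, the payoff when the opponent is first is `-f`.
    S.integral_reward_le (V := -V) hα (by decide) hg.neg hf.neg hh.neg hVm.neg hgs' hfs' hhs' hVs'
      hp₁
      (fun x => by
        have := (hR.lower hp₁ hmid hV x).1
        simp only [Pi.neg_apply]
        linarith)
      (fun x => by
        have := (hR.lower hp₁ hmid hV x).2
        simp only [Pi.neg_apply, contVal_neg]
        linarith) hτ x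
  have ha₁ := S.markovTime_mem_admissible 0 hp₁.1
  have ha₂ := S.markovTime_mem_admissible 1 hp₂.1
  -- The pair is admissible in both bounds, which give `J ≤ V` and `-J ≤ -V`.
  have hval : S.HasValue (Payoffs.zeroSum f g h) p₁ p₂ V := fun x => by
    have h1 := hlow x _ ha₂
    rw [J₂_zeroSum] at h1
    exact le_antisymm (by linarith) (hup x _ ha₁)
  refine ⟨⟨hp₁, hp₂, fun x => ⟨ha₁, ha₂, ⟨?_, ?_⟩, ⟨?_, ?_⟩⟩⟩, hval⟩
  · rintro _ ⟨τ, hτ, rfl⟩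
    exact (hup x τ hτ).trans_eq (hval x)
  · exact fun b hb => hb ⟨_, ha₁, rfl⟩
  · rintro _ ⟨τ, hτ, rfl⟩
    refine (hlow x τ hτ).trans_eq ?_
    rw [J₂_zeroSum, hval x]
  · exact fun b hb => hb ⟨_, ha₂, rfl⟩

end Setting

end MarkovDynkin

end

theorem mainTheorem3 {E Ω : Type*} [MeasurableSpace E] [MeasurableSpace Ω]
    (Q : ProbabilityTheory.Kernel E E) [ProbabilityTheory.IsMarkovKernel Q]
    (α : ℝ) (hα0 : 0 < α) (hα1 : α < 1)
    (S : MarkovDynkin.Setting Ω Q α)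
    (f g h : E → ℝ) (hf : Measurable f) (hg : Measurable g) (hh : Measurable h)
    (hint : S.IntegrablePayoffs (MarkovDynkin.Payoffs.zeroSum f g h))
    (hmid : ∀ x, h x = MarkovDynkin.med (f x) (h x) (g x)) :
    (∃ V : E → ℝ, Measurable V ∧
      (∀ x, MeasureTheory.Integrable V (Q x)) ∧
      (∀ x, V x = if f x < g x
        then MarkovDynkin.med (f x) (MarkovDynkin.contVal Q α V x) (g x) else h x) ∧
      (∀ n, Measurable (MarkovDynkin.iter Q α f g h n)) ∧
      (∀ n x, MeasureTheory.Integrable (MarkovDynkin.iter Q α f g h n) (Q x)) ∧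
      (∀ x, Monotone fun n => MarkovDynkin.iter Q α f g h n x) ∧
      (∀ x, Filter.Tendsto (fun n => MarkovDynkin.iter Q α f g h (n + 1) x)
        Filter.atTop (nhds (V x)))) ∧
    (∀ V : E → ℝ, Measurable V →
      (∀ x, V x = if f x < g x
        then MarkovDynkin.med (f x) (MarkovDynkin.contVal Q α V x) (g x) else h x) →
      (∀ p₁ p₂ : E → ℝ, MarkovDynkin.IsStrategy p₁ → MarkovDynkin.IsStrategy p₂ →
        MarkovDynkin.NineCaseRule Q α f g V p₁ p₂ →
        S.IsGlobalEquilibrium (MarkovDynkin.Payoffs.zeroSum f g h) p₁ p₂ ∧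
        S.HasValue (MarkovDynkin.Payoffs.zeroSum f g h) p₁ p₂ V) ∧
      (∃ p₁ p₂ : E → ℝ, MarkovDynkin.IsStrategy p₁ ∧ MarkovDynkin.IsStrategy p₂ ∧
        MarkovDynkin.IsPure p₁ ∧ MarkovDynkin.IsPure p₂ ∧
        MarkovDynkin.NineCaseRule Q α f g V p₁ p₂ ∧
        S.IsGlobalEquilibrium (MarkovDynkin.Payoffs.zeroSum f g h) p₁ p₂ ∧
        S.HasValue (MarkovDynkin.Payoffs.zeroSum f g h) p₁ p₂ V)) := by
  obtain ⟨hfs, hgs, hhs⟩ : S.SupIntegrable f ∧ S.SupIntegrable g ∧ S.SupIntegrable h := hint 0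
  refine ⟨MarkovDynkin.exists_fixedPoint hα0.le hf hg hh (S.integrable_kernel hα0 hf hfs)
    (S.integrable_kernel hα0 hg hgs) (S.integrable_kernel hα0 hh hhs), fun V hVm hV => ?_⟩
  have key := fun p₁ p₂ h₁ h₂ hR => S.isGlobalEquilibrium_of_nineCaseRule (p₁ := p₁) (p₂ := p₂)
    hα0 hf hg hh hint hmid hVm hV h₁ h₂ hR
  obtain ⟨p₁, p₂, h₁, h₂, hp₁, hp₂, hR⟩ :=
    MarkovDynkin.exists_pure_nineCaseRule (Q := Q) (α := α) hf hg hVm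
  exact ⟨key, p₁, p₂, h₁, h₂, hp₁, hp₂, hR, key p₁ p₂ h₁ h₂ hR⟩
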